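/- Let $K$ be a field of characteristic zero (for instance $\mathbb{Q}$), and let $H^*(X)=H^*(X;K)$ denote singular cohomology. For a space $X$, let $a,b,c$ be singular cocycles of $X$ of degrees $p,r,s$ with nonzero cohomology classes, and suppose that $a\cup b=\delta g$ and $b\cup c=\delta h$ for some cochains $g,h$ (of degrees $p+r-1$ and $r+s-1$). Then $g\cup c+(-1)^{p-1}a\cup h$ is a cocycle of degree $p+r+s-1$, whose class in $$H^{p+r+s-1}(X)\big/\big([a]\,H^{r+s-1}(X)+H^{p+r-1}(X)\,[c]\big)$$ is the triple Massey product $\langle[a],[b],[c]\rangle$. We say that $X$ has a nontrivial triple Massey product in $H^q(X)$ if for some such $a,b,c,g,h$ with $p+r+s-1=q$ this class is nonzero. Let $X_1$ and $X_2$ be simply connected (topological) manifolds of dimension $N$, and let $X_1\# X_2$ be a connected sum: given open embeddings $e_i:\mathbb{R}^N\to X_i$, it is obtained from $X_1\setminus e_1(\{|v|<1\})$ and $X_2\setminus e_2(\{|v|<1\})$ by identifying $e_1(v)$ with $e_2(v)$ for all $|v|=1$. If there is a nontrivial triple Massey product in $H^q(X_1)$ with $q\le N-3$, then there is a nontrivial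 triple Massey product in $H^q(X_1\# X_2)$. -/

import Mathlib

/-! ## Singular cochains and the cup product -/

namespace SingularCohomology

noncomputable section

/-- The affine map `Δᵐ → Δⁿ` of standard simplices induced by a map of their vertices. -/
def simplexMap {m n : ℕ} (f : Fin (m + 1) → Fin (n + 1)) :
    C(stdSimplex ℝ (Fin (m + 1)), stdSimplex ℝ (Fin (n + 1))) :=
  ⟨stdSimplex.map f, stdSimplex.continuous_map f⟩

theorem simplexMap_comp {l m n : ℕ} (g : Fin (m + 1) → Fin (n + 1))
    (f : Fin (l + 1) → Fin (m + 1)) :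
    (simplexMap g).comp (simplexMap f) = simplexMap (g ∘ f) := by
  ext x : 1
  exact stdSimplex.map_comp_apply f g x

/-- Singular `n`-cochains of `X` with coefficients in `K`: all functions on the set of singular
`n`-simplices of `X`. -/
abbrev Cochain (K : Type*) (X : Type*) [TopologicalSpace X] (n : ℕ) : Type _ :=
  C(stdSimplex ℝ (Fin (n + 1)), X) → K

variable (K : Type*) [Field K] (X : Type*) [TopologicalSpace X]

/-- The singular coboundary `(δ f)(σ) = ∑ᵢ (-1)ⁱ f(σ ∘ dᵢ)`. -/
def coboundary (n : ℕ) : Cochain K X n →ₗ[K] Cochain K X (n + 1) where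
  toFun f σ := ∑ i : Fin (n + 2), (-1 : K) ^ (i : ℕ) * f (σ.comp (simplexMap i.succAbove))
  map_add' f g := by
    funext σ
    simp [mul_add, Finset.sum_add_distrib]
  map_smul' c f := by
    funext σ
    simp only [Pi.smul_apply, smul_eq_mul, RingHom.id_apply, Finset.mul_sum]
    exact Finset.sum_congr rfl fun i _ => by ring

/-- The inclusion of the vertices of the front `p`-face of `Δⁿ`. -/
def front {p n : ℕ} (h : p ≤ n) (i : Fin (p + 1)) : Fin (n + 1) :=
  ⟨i, by omega⟩

/-- The inclusion of the vertices of the back `q`-face of `Δⁿ`, where `n = p + q`. -/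
def back {p q n : ℕ} (h : p + q = n) (j : Fin (q + 1)) : Fin (n + 1) :=
  ⟨p + j, by omega⟩

variable {X}

/-- The cup product of singular cochains: `(a ∪ b)(σ) = a(front p-face of σ) b(back q-face of σ)`. -/
def cup {p q n : ℕ} (h : p + q = n) :
    Cochain K X p →ₗ[K] Cochain K X q →ₗ[K] Cochain K X n :=
  LinearMap.mk₂ K
    (fun a b σ => a (σ.comp (simplexMap (front (Nat.le.intro h)))) *
      b (σ.comp (simplexMap (back h))))
    (fun a a' b => by funext σ; simp [add_mul])
    (fun c a b => by funext σ; simp [mul_assoc])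
    (fun a b b' => by funext σ; simp [mul_add])
    (fun c a b => by funext σ; simp [mul_left_comm])

variable {K}

theorem cup_apply {p q n : ℕ} (h : p + q = n) (a : Cochain K X p) (b : Cochain K X q)
    (σ : C(stdSimplex ℝ (Fin (n + 1)), X)) :
    cup K h a b σ = a (σ.comp (simplexMap (front (Nat.le.intro h)))) *
      b (σ.comp (simplexMap (back h))) := rfl

/-- The coface maps on vertices, indexed by natural numbers. -/
def cofaceNat (n i : ℕ) (j : Fin (n + 1)) : Fin (n + 2) :=
  ⟨if (j : ℕ) < i then j else j + 1, by split <;> omega⟩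

theorem coboundary_apply {n : ℕ} (f : Cochain K X n)
    (σ : C(stdSimplex ℝ (Fin (n + 2)), X)) :
    coboundary K X n f σ =
      ∑ i ∈ Finset.range (n + 2), (-1 : K) ^ i * f (σ.comp (simplexMap (cofaceNat n i))) := by
  rw [← Fin.sum_univ_eq_sum_range
    (fun i : ℕ => (-1 : K) ^ i * f (σ.comp (simplexMap (cofaceNat n i)))) (n + 2)]
  change ∑ i : Fin (n + 2), (-1 : K) ^ (i : ℕ) * f (σ.comp (simplexMap i.succAbove)) = _
  refine Finset.sum_congr rfl fun i _ => ?_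
  have hi : i.succAbove = cofaceNat n i := by
    funext j
    apply Fin.ext
    simp only [cofaceNat, Fin.succAbove, Fin.lt_def, Fin.val_castSucc]
    split <;> simp
  rw [hi]

/-- The Leibniz rule `δ(a ∪ b) = δa ∪ b + (-1)ᵖ a ∪ δb`. -/
theorem coboundary_cup {p q n : ℕ} (h : p + q = n) (a : Cochain K X p) (b : Cochain K X q) :
    coboundary K X n (cup K h a b) =
      cup K (show p + 1 + q = n + 1 by omega) (coboundary K X p a) b +
        (-1 : K) ^ p • cup K (show p + (q + 1) = n + 1 by omega) a (coboundary K X q b) := by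
  subst h
  have hr : Finset.range (p + q + 2) = Finset.range ((p + 1) + (q + 1)) :=
    congrArg Finset.range (by omega)
  funext σ
  simp only [Pi.add_apply, Pi.smul_apply, smul_eq_mul, cup_apply, coboundary_apply,
    ContinuousMap.comp_assoc, simplexMap_comp]
  rw [Finset.sum_mul, Finset.mul_sum, Finset.mul_sum, Finset.sum_range_succ _ (p + 1),
    Finset.sum_range_succ' _ (q + 1), hr, Finset.sum_range_add]
  have e1 : ∀ i ∈ Finset.range (p + 1),
      (-1 : K) ^ i * (a (σ.comp (simplexMap (cofaceNat (p + q) i ∘ front (Nat.le_add_right p q)))) *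
        b (σ.comp (simplexMap (cofaceNat (p + q) i ∘ back rfl)))) =
      (-1 : K) ^ i * a (σ.comp (simplexMap (front (show p + 1 ≤ p + q + 1 by omega) ∘
        cofaceNat p i))) *
        b (σ.comp (simplexMap (back (show p + 1 + q = p + q + 1 by omega)))) := by
    intro i hi
    rw [Finset.mem_range] at hi
    have h2 : cofaceNat (p + q) i ∘ back rfl = back (show p + 1 + q = p + q + 1 by omega) := by
      funext j
      apply Fin.ext
      simp only [cofaceNat, back, Function.comp_apply]
      grind
    rw [h2, mul_assoc]
    rfl
  have e2 : ∀ i ∈ Finset.range (q + 1),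
      (-1 : K) ^ (p + 1 + i) *
        (a (σ.comp (simplexMap (cofaceNat (p + q) (p + 1 + i) ∘ front (Nat.le_add_right p q)))) *
        b (σ.comp (simplexMap (cofaceNat (p + q) (p + 1 + i) ∘ back rfl)))) =
      (-1 : K) ^ p * (a (σ.comp (simplexMap (front (show p ≤ p + q + 1 by omega)))) *
        ((-1 : K) ^ (i + 1) * b (σ.comp (simplexMap (back (show p + (q + 1) = p + q + 1 by omega) ∘
          cofaceNat q (i + 1)))))) := by
    intro i hi
    have h1 : cofaceNat (p + q) (p + 1 + i) ∘ front (Nat.le_add_right p q) =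
        front (show p ≤ p + q + 1 by omega) := by
      funext j
      apply Fin.ext
      simp only [cofaceNat, front, Function.comp_apply]
      grind
    have h2 : cofaceNat (p + q) (p + 1 + i) ∘ back rfl =
        back (show p + (q + 1) = p + q + 1 by omega) ∘ cofaceNat q (i + 1) := by
      funext j
      apply Fin.ext
      simp only [cofaceNat, back, Function.comp_apply]
      grind
    rw [h1, h2]
    ring
  have h3 : front (show p + 1 ≤ p + q + 1 by omega) ∘ cofaceNat p (p + 1) =
      front (show p ≤ p + q + 1 by omega) := by
    funext j
    apply Fin.ext
    simp only [cofaceNat, front, Function.comp_apply]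
    grind
  have h4 : back (show p + (q + 1) = p + q + 1 by omega) ∘ cofaceNat q 0 =
      back (show p + 1 + q = p + q + 1 by omega) := by
    funext j
    apply Fin.ext
    simp only [cofaceNat, back, Function.comp_apply]
    grind
  rw [Finset.sum_congr rfl e1, Finset.sum_congr rfl e2, h3, h4]
  ring

/-- Associativity of the cup product. -/
theorem cup_assoc {p q r s t n : ℕ} (hpq : p + q = s) (hqr : q + r = t) (h₁ : s + r = n)
    (h₂ : p + t = n) (a : Cochain K X p) (b : Cochain K X q) (c : Cochain K X r) :
    cup K h₁ (cup K hpq a b) c = cup K h₂ a (cup K hqr b c) := by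
  subst hpq hqr h₁
  funext σ
  have h3 : (back (rfl : p + q + r = p + q + r)) = back h₂ ∘ back (rfl : q + r = q + r) := by
    funext j
    apply Fin.ext
    simp [back, add_assoc]
  simp only [cup_apply, ContinuousMap.comp_assoc, simplexMap_comp, mul_assoc]
  rw [h3]
  rfl

/-! ## Singular cohomology -/

variable (K X)

/-- The `n`-cocycles. -/
def cocycles (n : ℕ) : Submodule K (Cochain K X n) :=
  LinearMap.ker (coboundary K X n)

/-- The `n`-coboundaries; there are no nonzero ones in degree `0`. -/
def coboundaries : (n : ℕ) → Submodule K (Cochain K X n)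
  | 0 => ⊥
  | n + 1 => LinearMap.range (coboundary K X n)

/-- Singular cohomology `Hⁿ(X; K)`, cocycles modulo coboundaries. -/
abbrev Cohomology (n : ℕ) : Type _ :=
  cocycles K X n ⧸ (coboundaries K X n).submoduleOf (cocycles K X n)

variable {K X}

/-- The cohomology class of a cocycle. -/
abbrev cls {n : ℕ} (a : cocycles K X n) : Cohomology K X n :=
  Submodule.Quotient.mk a

theorem cup_mem_cocycles {p q n : ℕ} (h : p + q = n) {a : Cochain K X p} {b : Cochain K X q}
    (ha : a ∈ cocycles K X p) (hb : b ∈ cocycles K X q) : cup K h a b ∈ cocycles K X n := by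
  rw [cocycles, LinearMap.mem_ker] at *
  simp [coboundary_cup, ha, hb]

theorem cup_mem_coboundaries_left {p q n : ℕ} (h : p + q = n) {a : Cochain K X p}
    {b : Cochain K X q} (ha : a ∈ coboundaries K X p) (hb : b ∈ cocycles K X q) :
    cup K h a b ∈ coboundaries K X n := by
  cases p with
  | zero =>
    have : a = 0 := ha
    simp [this]
  | succ p =>
    obtain ⟨a', rfl⟩ := ha
    obtain rfl : n = (p + q) + 1 := by omega
    have hb' : coboundary K X q b = 0 := hb
    exact ⟨cup K rfl a' b, by simp [coboundary_cup, hb']⟩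

theorem cup_mem_coboundaries_right {p q n : ℕ} (h : p + q = n) {a : Cochain K X p}
    {b : Cochain K X q} (ha : a ∈ cocycles K X p) (hb : b ∈ coboundaries K X q) :
    cup K h a b ∈ coboundaries K X n := by
  cases q with
  | zero =>
    have : b = 0 := hb
    simp [this]
  | succ q =>
    obtain ⟨b', rfl⟩ := hb
    obtain rfl : n = (p + q) + 1 := by omega
    have ha' : coboundary K X p a = 0 := ha
    refine ⟨(-1 : K) ^ p • cup K rfl a b', ?_⟩
    rw [map_smul, coboundary_cup, ha', map_zero, LinearMap.zero_apply, zero_add, smul_smul,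
      ← mul_pow]
    simp

/-- Left multiplication `[y] ↦ [a ∪ y]` on cohomology by a cocycle `a`. -/
def cupLeft {p q n : ℕ} (h : p + q = n) (a : cocycles K X p) :
    Cohomology K X q →ₗ[K] Cohomology K X n :=
  Submodule.mapQ _ _
    ((cup K h a.1).restrict fun _ hy => cup_mem_cocycles h a.2 hy)
    (fun _ hy => cup_mem_coboundaries_right h a.2 hy)

/-- Right multiplication `[y] ↦ [y ∪ c]` on cohomology by a cocycle `c`. -/
def cupRight {p q n : ℕ} (h : p + q = n) (c : cocycles K X q) :
    Cohomology K X p →ₗ[K] Cohomology K X n :=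
  Submodule.mapQ _ _
    (((cup K h).flip c.1).restrict fun _ hy => cup_mem_cocycles h hy c.2)
    (fun _ hy => cup_mem_coboundaries_left h hy c.2)

/-! ## Triple Massey products -/

/-- If `a ∪ b = δg` and `b ∪ c = δh` for cocycles `a, b, c`, then
`g ∪ c + (-1)ᵖ⁻¹ a ∪ h`, with `p` the degree of `a`, is a cocycle.
The sign is written `(-1)ᵖ⁺¹` to avoid the subtraction. -/
theorem massey_mem_cocycles {p q r s t n : ℕ} (hs : p + q = s + 1) (ht : q + r = t + 1)
    (hn : s + r = n) (hn' : p + t = n) (a : cocycles K X p) (b : cocycles K X q)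
    (c : cocycles K X r) (g : Cochain K X s) (h : Cochain K X t)
    (hg : cup K hs a.1 b.1 = coboundary K X s g) (hh : cup K ht b.1 c.1 = coboundary K X t h) :
    cup K hn g c.1 + (-1 : K) ^ (p + 1) • cup K hn' a.1 h ∈ cocycles K X n := by
  have ha : coboundary K X p a.1 = 0 := a.2
  have hc : coboundary K X r c.1 = 0 := c.2
  rw [cocycles, LinearMap.mem_ker, map_add, map_smul, coboundary_cup, coboundary_cup, ha, hc,
    ← hg, ← hh, cup_assoc hs ht _ (show p + (t + 1) = n + 1 by omega)]
  simp only [map_zero, smul_zero, add_zero, LinearMap.zero_apply, zero_add, smul_smul, ← pow_add]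
  rw [show p + 1 + p = 2 * p + 1 by ring, pow_succ, pow_mul]
  simp

/-- `X` has a nontrivial triple Massey product in `Hⁿ(X; K)`: there are cocycles `a, b, c`, of
degrees `p, q, r`, with nonzero cohomology classes, and cochains `g, h` with `a ∪ b = δg` and
`b ∪ c = δh` (in particular `[a] ∪ [b] = 0` and `[b] ∪ [c] = 0`), such that
`n = p + q + r - 1` and the class of the cocycle `g ∪ c + (-1)ᵖ⁻¹ a ∪ h` is nonzero in
`Hⁿ / ([a] H^{q+r-1} + H^{p+q-1} [c])`.
Here `s = p + q - 1` and `t = q + r - 1`. -/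
def HasNontrivialTripleMasseyProduct (K : Type*) [Field K] (X : Type*) [TopologicalSpace X]
    (n : ℕ) : Prop :=
  ∃ (p q r s t : ℕ) (hs : p + q = s + 1) (ht : q + r = t + 1) (hn : s + r = n) (hn' : p + t = n)
    (a : cocycles K X p) (b : cocycles K X q) (c : cocycles K X r)
    (g : Cochain K X s) (h : Cochain K X t)
    (hg : cup K hs a.1 b.1 = coboundary K X s g) (hh : cup K ht b.1 c.1 = coboundary K X t h),
    cls a ≠ 0 ∧ cls b ≠ 0 ∧ cls c ≠ 0 ∧
      cls ⟨_, massey_mem_cocycles hs ht hn hn' a b c g h hg hh⟩ ∉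
        LinearMap.range (cupLeft hn' a) ⊔ LinearMap.range (cupRight hn c)

end

end SingularCohomology

/-! ## Connected sums -/

/-- The gluing relation of the connected sum: the boundary point `e₁ v`, `‖v‖ = 1`, of
`X₁ ∖ e₁(open unit ball)` is identified with the boundary point `e₂ v` of
`X₂ ∖ e₂(open unit ball)`. -/
def ConnectedSum.Glue {N : ℕ} {X₁ X₂ : Type*}
    (e₁ : EuclideanSpace ℝ (Fin N) → X₁) (e₂ : EuclideanSpace ℝ (Fin N) → X₂)
    (x y : {x : X₁ // x ∉ e₁ '' Metric.ball 0 1} ⊕ {x : X₂ // x ∉ e₂ '' Metric.ball 0 1}) : Prop :=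
  ∃ v : EuclideanSpace ℝ (Fin N), ‖v‖ = 1 ∧
    ∃ x₁ x₂, x = Sum.inl x₁ ∧ y = Sum.inr x₂ ∧ x₁.1 = e₁ v ∧ x₂.1 = e₂ v

/-- The connected sum `X₁ # X₂` formed along the discs `eᵢ(closed unit ball)`, where `eᵢ` is an
open embedding of `ℝᴺ` into `Xᵢ`: remove the interiors of the discs and glue along the boundary
spheres. It carries the quotient topology. Composing `e₂` with a reflection
gives the other identification of the two spheres. -/
def ConnectedSum {N : ℕ} {X₁ X₂ : Type*}
    (e₁ : EuclideanSpace ℝ (Fin N) → X₁) (e₂ : EuclideanSpace ℝ (Fin N) → X₂) : Type _ :=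
  Quot (ConnectedSum.Glue e₁ e₂)

instance ConnectedSum.instTopologicalSpace {N : ℕ} {X₁ X₂ : Type*} [TopologicalSpace X₁]
    [TopologicalSpace X₂]
    (e₁ : EuclideanSpace ℝ (Fin N) → X₁) (e₂ : EuclideanSpace ℝ (Fin N) → X₂) :
    TopologicalSpace (ConnectedSum e₁ e₂) :=
  inferInstanceAs (TopologicalSpace (Quot (ConnectedSum.Glue e₁ e₂)))

/-!
The second summand plays no role. Let `A` be the complement in `X₁` of the centre of the disc.
Collapsing the second summand gives a map `X₁ # X₂ → X₁`, and by stretching the disc radially one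
finds a map `A → X₁ # X₂` such that the composition `A → X₁ # X₂ → X₁` is the inclusion exactly
(`ConnectedSum.collapse_comp_expand`).

The inclusion of `A` induces an injection on cohomology in degrees up to `N - 1`, and a surjection
in degrees up to `N - 2` (`mem_coboundaries_of_pullback_compl`, `exists_pullback_compl_eq`). This
transfers Massey products (`HasNontrivialTripleMasseyProduct.of_factorization`): pull `a, b, c, g,
h` back to `X₁ # X₂`. If the pulled back class were of the form `[a] y + z [c]`, restrict this relation
to `A`. There `y` and `z` extend to `X₁` by surjectivity, so that by injectivity the original class
would lie in the indeterminacy in `X₁`.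

The statement on the inclusion of `A` is the dual of the relative acyclicity of `(X₁, A)` on
simplices with at most `N` vertices (`SingularChain.exists_relative_boundary`). A relative cycle is
barycentrically subdivided into a chain in the coordinate neighbourhood and a chain in `A`, and so
everything reduces to the vanishing of the reduced homology of `ℝᴺ ∖ {0}` below degree `N - 1`
(`SingularChain.acyclicBelow_compl_zero`). This follows by Mayer–Vietoris, without homotopy
invariance, from a cover by `N + 1` open half-spaces any `N` of which meet, since convex sets are
acyclic by the cone construction.

Simplices are counted by their number of vertices. As the simplex without vertices is empty, a
space has exactly one singular simplex of this kind, and the complexes below are augmented without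
further provision. Subdivision is carried out in the complex of tuples of points, where it is
purely combinatorial, and transferred to singular simplices by naturality.
-/

/-! ### The chain complex of ordered tuples -/

noncomputable section

namespace TupleChain

variable (K : Type*) [Field K] {V W : Type*}

/-- Formal linear combinations of `k`-tuples of points of `V`. A tuple stands for the (possibly
degenerate) affine simplex with these vertices, so the complex is indexed by the number of
vertices, and the empty tuple provides its augmentation. -/
abbrev Chain (V : Type*) (k : ℕ) : Type _ := (Fin k → V) →₀ K

/-- The chain consisting of one tuple. -/
abbrev of {k : ℕ} (v : Fin k → V) : Chain K V k := Finsupp.single v 1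

/-- The augmented boundary, `∑ᵢ (-1)ⁱ` times the tuple with its `i`-th entry omitted. -/
def boundary (k : ℕ) : Chain K V (k + 1) →ₗ[K] Chain K V k :=
  Finsupp.linearCombination K fun v => ∑ i : Fin (k + 1), (-1 : K) ^ (i : ℕ) •
    of K (v ∘ i.succAbove)

/-- The cone operator, which puts the point `b` in front of each tuple. -/
def cone (b : V) (k : ℕ) : Chain K V k →ₗ[K] Chain K V (k + 1) :=
  Finsupp.lmapDomain K K fun v => Fin.cons b v

/-- The map induced on tuples by a map of points. -/
def map (f : V → W) (k : ℕ) : Chain K V k →ₗ[K] Chain K W k :=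
  Finsupp.lmapDomain K K fun v => f ∘ v

variable {K}

theorem ext_of {M : Type*} [AddCommGroup M] [Module K M] {k : ℕ} {φ ψ : Chain K V k →ₗ[K] M}
    (h : ∀ v, φ (of K v) = ψ (of K v)) : φ = ψ :=
  Finsupp.lhom_ext' fun v => LinearMap.ext_ring (h v)

theorem boundary_of {k : ℕ} (v : Fin (k + 1) → V) :
    boundary K k (of K v) = ∑ i : Fin (k + 1), (-1 : K) ^ (i : ℕ) • of K (v ∘ i.succAbove) := by
  simp [boundary, of]

theorem cone_of {k : ℕ} (b : V) (v : Fin k → V) :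
    cone K b k (of K v) = of K (Fin.cons b v : Fin (k + 1) → V) := by
  simp [cone, of]

theorem map_of {k : ℕ} (f : V → W) (v : Fin k → V) : map K f k (of K v) = of K (f ∘ v) := by
  simp [map, of]

theorem boundary_cone_zero (b : V) (z : Chain K V 0) : boundary K 0 (cone K b 0 z) = z := by
  suffices h : boundary K 0 ∘ₗ cone K b 0 = LinearMap.id from LinearMap.congr_fun h z
  refine ext_of fun v => ?_
  rw [LinearMap.comp_apply, cone_of, boundary_of, Fin.sum_univ_succ]
  simp only [Fin.val_zero, pow_zero, one_smul, Finset.univ_eq_empty, Finset.sum_empty, add_zero]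
  exact congrArg (of K) (Subsingleton.elim _ v)

theorem boundary_cone (b : V) {k : ℕ} (z : Chain K V (k + 1)) :
    boundary K (k + 1) (cone K b (k + 1) z) = z - cone K b k (boundary K k z) := by
  suffices h : boundary K (k + 1) ∘ₗ cone K b (k + 1) =
      LinearMap.id - cone K b k ∘ₗ boundary K k from LinearMap.congr_fun h z
  refine ext_of fun v => ?_
  have h0 : (Fin.cons b v : Fin (k + 2) → V) ∘ (0 : Fin (k + 2)).succAbove = v := by
    funext j
    simp
  have h1 : ∀ i : Fin (k + 1), (Fin.cons b v : Fin (k + 2) → V) ∘ i.succ.succAbove =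
      Fin.cons b (v ∘ i.succAbove) := by
    intro i
    funext j
    cases j using Fin.cases <;> simp
  simp only [LinearMap.comp_apply, LinearMap.sub_apply, cone_of, boundary_of, LinearMap.id_apply,
    map_sum, map_smul]
  rw [Fin.sum_univ_succ, h0, sub_eq_add_neg, ← Finset.sum_neg_distrib]
  simp [h1, pow_succ]

/-- Every tuple is a cone over its tail, and on cones the claim follows by induction. -/
theorem boundary_boundary {k : ℕ} (z : Chain K V (k + 2)) :
    boundary K k (boundary K (k + 1) z) = 0 := by
  induction k with
  | zero =>
    suffices h : boundary K 0 ∘ₗ boundary K 1 = (0 : Chain K V 2 →ₗ[K] _) from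
      LinearMap.congr_fun h z
    refine ext_of fun v => ?_
    rw [← Fin.cons_self_tail v, ← cone_of, LinearMap.comp_apply, boundary_cone, map_sub,
      boundary_cone_zero, sub_self, LinearMap.zero_apply]
  | succ k ih =>
    suffices h : boundary K (k + 1) ∘ₗ boundary K (k + 2) = (0 : Chain K V (k + 3) →ₗ[K] _) from
      LinearMap.congr_fun h z
    refine ext_of fun v => ?_
    rw [← Fin.cons_self_tail v, ← cone_of, LinearMap.comp_apply, boundary_cone, map_sub,
      boundary_cone, ih, map_zero, sub_zero, sub_self, LinearMap.zero_apply]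

theorem map_boundary (f : V → W) {k : ℕ} (z : Chain K V (k + 1)) :
    map K f k (boundary K k z) = boundary K k (map K f (k + 1) z) := by
  suffices h : map K f k ∘ₗ boundary K k = boundary K k ∘ₗ map K f (k + 1) from
    LinearMap.congr_fun h z
  refine ext_of fun v => ?_
  simp only [LinearMap.comp_apply, boundary_of, map_of, map_sum, map_smul]
  rfl

theorem map_cone (f : V → W) (b : V) {k : ℕ} (z : Chain K V k) :
    map K f (k + 1) (cone K b k z) = cone K (f b) k (map K f k z) := by
  suffices h : map K f (k + 1) ∘ₗ cone K b k = cone K (f b) k ∘ₗ map K f k from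
    LinearMap.congr_fun h z
  refine ext_of fun v => ?_
  simp only [LinearMap.comp_apply, cone_of, map_of]
  rw [Fin.comp_cons]

/-! ### Subdivision of tuples -/

variable (K)

/-- Subdivision with respect to a choice `b` of a centre for each nonempty tuple: the cone from
the centre over the subdivided boundary. With barycentres this is barycentric subdivision, but
that it is a chain map homotopic to the identity holds for arbitrary centres. -/
def sd (b : ∀ {k : ℕ}, (Fin (k + 1) → V) → V) : (k : ℕ) → Chain K V k →ₗ[K] Chain K V k
  | 0 => LinearMap.id
  | k + 1 => Finsupp.linearCombination K fun v =>
      cone K (b v) k (sd b k (boundary K k (of K v)))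

/-- The chain homotopy from the identity to subdivision. -/
def sdHomotopy (b : ∀ {k : ℕ}, (Fin (k + 1) → V) → V) :
    (k : ℕ) → Chain K V k →ₗ[K] Chain K V (k + 1)
  | 0 => 0
  | k + 1 => Finsupp.linearCombination K fun v =>
      cone K (b v) (k + 1) (of K v - sdHomotopy b k (boundary K k (of K v)))

variable {K}
variable (b : ∀ {k : ℕ}, (Fin (k + 1) → V) → V) (c : ∀ {k : ℕ}, (Fin (k + 1) → W) → W)

theorem sd_zero (z : Chain K V 0) : sd K b 0 z = z := rfl

theorem sd_of {k : ℕ} (v : Fin (k + 1) → V) :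
    sd K b (k + 1) (of K v) = cone K (b v) k (sd K b k (boundary K k (of K v))) := by
  simp [sd, of]

theorem sdHomotopy_zero (z : Chain K V 0) : sdHomotopy K b 0 z = 0 := rfl

theorem sdHomotopy_of {k : ℕ} (v : Fin (k + 1) → V) :
    sdHomotopy K b (k + 1) (of K v) =
      cone K (b v) (k + 1) (of K v - sdHomotopy K b k (boundary K k (of K v))) := by
  simp [sdHomotopy, of]

theorem boundary_sd {k : ℕ} (z : Chain K V (k + 1)) :
    boundary K k (sd K b (k + 1) z) = sd K b k (boundary K k z) := by
  suffices h : boundary K k ∘ₗ sd K b (k + 1) = sd K b k ∘ₗ boundary K k from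
    LinearMap.congr_fun h z
  refine ext_of fun v => ?_
  rw [LinearMap.comp_apply, sd_of, LinearMap.comp_apply]
  cases k with
  | zero => exact boundary_cone_zero _ _
  | succ k => rw [boundary_cone, boundary_sd, boundary_boundary, map_zero, map_zero, sub_zero]

theorem boundary_sdHomotopy_zero (z : Chain K V 0) :
    boundary K 0 (sdHomotopy K b 0 z) = z - sd K b 0 z := by
  simp [sd_zero, sdHomotopy_zero]

theorem boundary_sdHomotopy {k : ℕ} (z : Chain K V (k + 1)) :
    boundary K (k + 1) (sdHomotopy K b (k + 1) z) =
      z - sd K b (k + 1) z - sdHomotopy K b k (boundary K k z) := by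
  suffices h : boundary K (k + 1) ∘ₗ sdHomotopy K b (k + 1) =
      LinearMap.id - sd K b (k + 1) - sdHomotopy K b k ∘ₗ boundary K k from
    LinearMap.congr_fun h z
  refine ext_of fun v => ?_
  simp only [LinearMap.comp_apply, LinearMap.sub_apply, LinearMap.id_apply, sdHomotopy_of, sd_of]
  rw [boundary_cone, map_sub]
  cases k with
  | zero => rw [boundary_sdHomotopy_zero, sub_sub_cancel]; abel
  | succ k =>
    rw [boundary_sdHomotopy, boundary_boundary, map_zero, sub_zero, sub_sub_cancel]
    abel

variable {b c} in
theorem map_sd {f : V → W} (hf : ∀ {k : ℕ} (v : Fin (k + 1) → V), f (b v) = c (f ∘ v)) {k : ℕ}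
    (z : Chain K V k) : map K f k (sd K b k z) = sd K c k (map K f k z) := by
  suffices h : map K f k ∘ₗ sd K b k = sd K c k ∘ₗ map K f k from LinearMap.congr_fun h z
  refine ext_of fun v => ?_
  cases k with
  | zero => rfl
  | succ k =>
    simp only [LinearMap.comp_apply, map_of, sd_of]
    rw [map_cone, map_sd hf, map_boundary, map_of, hf]

variable {b c} in
theorem map_sdHomotopy {f : V → W}
    (hf : ∀ {k : ℕ} (v : Fin (k + 1) → V), f (b v) = c (f ∘ v)) {k : ℕ} (z : Chain K V k) :
    map K f (k + 1) (sdHomotopy K b k z) = sdHomotopy K c k (map K f k z) := by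
  suffices h : map K f (k + 1) ∘ₗ sdHomotopy K b k = sdHomotopy K c k ∘ₗ map K f k from
    LinearMap.congr_fun h z
  refine ext_of fun v => ?_
  cases k with
  | zero => simp [sdHomotopy_zero]
  | succ k =>
    simp only [LinearMap.comp_apply, map_of, sdHomotopy_of]
    rw [map_cone, map_sub, map_sdHomotopy hf, map_boundary, map_of, hf]

end TupleChain

end

/-! ### Affine maps of standard simplices and the mesh of a subdivision -/

noncomputable section

namespace SimplexAffine

open Finset

/-- The affine map `Δ^{k-1} → Δ^{m-1}` which takes the `i`-th vertex to the point `v i`. -/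
def affine {k m : ℕ} (v : Fin k → stdSimplex ℝ (Fin m)) :
    C(stdSimplex ℝ (Fin k), stdSimplex ℝ (Fin m)) where
  toFun t := ⟨∑ i, t i • (v i).1,
    (convex_stdSimplex ℝ (Fin m)).sum_mem (fun i _ => t.2.1 i) t.2.2 fun i _ => (v i).2⟩
  continuous_toFun := by
    refine Continuous.subtype_mk (continuous_finsetSum _ fun i _ => ?_) _
    have h : Continuous fun t : stdSimplex ℝ (Fin k) => t.1 i :=
      (continuous_apply i).comp continuous_subtype_val
    exact h.smul continuous_const

variable {k l m : ℕ}

theorem affine_val (v : Fin k → stdSimplex ℝ (Fin m)) (t : stdSimplex ℝ (Fin k)) :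
    (affine v t).1 = ∑ i, t i • (v i).1 := rfl

theorem affine_apply (v : Fin k → stdSimplex ℝ (Fin m)) (t : stdSimplex ℝ (Fin k)) (x : Fin m) :
    affine v t x = ∑ i, t i * v i x := by
  change (affine v t).1 x = _
  rw [affine_val, Finset.sum_apply]
  rfl

theorem affine_affine (v : Fin l → stdSimplex ℝ (Fin m)) (w : Fin k → stdSimplex ℝ (Fin l)) :
    affine (fun i => affine v (w i)) = (affine v).comp (affine w) := by
  ext t x
  simp only [ContinuousMap.comp_apply, affine_apply, mul_sum, sum_mul]
  rw [sum_comm]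
  simp only [mul_assoc]

theorem affine_vertex_apply (v : Fin k → stdSimplex ℝ (Fin m)) (i : Fin k) :
    affine v (stdSimplex.vertex i) = v i := by
  ext x
  simp [affine_apply, Pi.single_apply]

theorem affine_vertex : affine (stdSimplex.vertex (S := ℝ) (X := Fin k)) = ContinuousMap.id _ := by
  ext t x
  simp [affine_apply, Pi.single_apply]

/-- The barycentre of the affine simplex with the given vertices. -/
def bary {k : ℕ} (v : Fin (k + 1) → stdSimplex ℝ (Fin m)) : stdSimplex ℝ (Fin m) :=
  affine v stdSimplex.barycenter

theorem affine_bary (w : Fin l → stdSimplex ℝ (Fin m)) (v : Fin (k + 1) → stdSimplex ℝ (Fin l)) :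
    affine w (bary v) = bary (affine w ∘ v) :=
  (DFunLike.congr_fun (affine_affine w v) stdSimplex.barycenter).symm

theorem simplexMap_eq_affine (f : Fin (k + 1) → Fin (m + 1)) :
    SingularCohomology.simplexMap f = affine fun i => stdSimplex.vertex (f i) := by
  ext t x
  rw [affine_apply]
  change FunOnFinite.linearMap ℝ ℝ f t x = _
  rw [FunOnFinite.linearMap_apply_apply, Finset.sum_filter]
  refine sum_congr rfl fun i _ => ?_
  simp [Pi.single_apply, eq_comm]

theorem affine_mem_of_convex {S : Set (Fin m → ℝ)} (hS : Convex ℝ S)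
    {v : Fin k → stdSimplex ℝ (Fin m)} (hv : ∀ i, (v i).1 ∈ S) (t : stdSimplex ℝ (Fin k)) :
    (affine v t).1 ∈ S :=
  hS.sum_mem (fun i _ => t.2.1 i) t.2.2 fun i _ => hv i

/-- In a simplex with `k + 1` vertices and edges of length at most `d`, the barycentre has
distance at most `k / (k + 1) * d` from every vertex. -/
theorem dist_bary_le {d : ℝ} (v : Fin (k + 1) → stdSimplex ℝ (Fin m))
    (hv : ∀ i j, dist (v i) (v j) ≤ d) (j : Fin (k + 1)) :
    dist (v j) (bary v) ≤ k / (k + 1) * d := by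
  have h1 : (bary v).1 - (v j).1 = ∑ i, (1 / (k + 1 : ℝ)) • ((v i).1 - (v j).1) := by
    have hb : ∀ i, (stdSimplex.barycenter : stdSimplex ℝ (Fin (k + 1))) i = 1 / (k + 1 : ℝ) := by
      intro i
      change ((Fintype.card (Fin (k + 1)) : ℝ))⁻¹ = _
      simp
    rw [bary, affine_val, ← smul_sum, sum_sub_distrib]
    simp only [hb, ← smul_sum, smul_sub, sum_const, card_univ, Fintype.card_fin]
    congr 1
    rw [← Nat.cast_smul_eq_nsmul ℝ, smul_smul]
    push_cast
    rw [one_div, inv_mul_cancel₀ (by positivity), one_smul]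
  rw [dist_comm, Subtype.dist_eq, dist_eq_norm, h1]
  refine (norm_sum_le _ _).trans ?_
  have h2 : ∀ i, ‖(1 / (k + 1 : ℝ)) • ((v i).1 - (v j).1)‖ ≤
      if i = j then 0 else 1 / (k + 1 : ℝ) * d := by
    intro i
    split_ifs with hij
    · simp [hij]
    · rw [norm_smul, Real.norm_of_nonneg (by positivity), ← dist_eq_norm, ← Subtype.dist_eq]
      exact mul_le_mul_of_nonneg_left (hv i j) (by positivity)
  refine (sum_le_sum fun i _ => h2 i).trans (le_of_eq ?_)
  rw [sum_ite, sum_const_zero, zero_add, sum_const, filter_ne', card_erase_of_mem (mem_univ _),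
    card_univ, Fintype.card_fin]
  simp
  ring

open TupleChain

variable {K : Type*} [Field K]

/-- The tuples whose entries lie in the convex hull of those of `v` and have mutual distances at
most `d`. -/
def smallIn {n : ℕ} (v : Fin n → stdSimplex ℝ (Fin m)) (d : ℝ) (k : ℕ) :
    Set (Fin k → stdSimplex ℝ (Fin m)) :=
  {w | (∀ i, (w i).1 ∈ convexHull ℝ (Set.range fun j => (v j).1)) ∧ ∀ i j, dist (w i) (w j) ≤ d}

/-- Barycentric subdivision shrinks the mesh of a simplex with `k` vertices by the factor
`(k - 1) / k`. -/
theorem sd_mem_smallIn {d : ℝ} (v : Fin k → stdSimplex ℝ (Fin m))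
    (hv : ∀ i j, dist (v i) (v j) ≤ d) :
    sd K bary k (of K v) ∈ Finsupp.supported K K (smallIn v (((k - 1 : ℝ) / k) * d) k) := by
  induction k with
  | zero =>
    exact Finsupp.single_mem_supported K 1 (And.intro (fun i => i.elim0) fun i => i.elim0)
  | succ k ih =>
    have hd : 0 ≤ d := dist_nonneg.trans (hv 0 0)
    rw [sd_of, boundary_of, map_sum, map_sum]
    refine Submodule.sum_mem _ fun i _ => ?_
    rw [map_smul, map_smul]
    refine Submodule.smul_mem _ _ ?_
    have h := ih (v ∘ i.succAbove) fun a b => hv _ _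
    rw [cone, ← Submodule.mem_comap]
    refine Set.mem_of_mem_of_subset h ?_
    rw [SetLike.coe_subset_coe, ← Submodule.map_le_iff_le_comap, Finsupp.lmapDomain_supported]
    refine Finsupp.supported_mono ?_
    rintro _ ⟨w, ⟨hw1, hw2⟩, rfl⟩
    have hk : ((k + 1 : ℕ) - 1 : ℝ) / (k + 1 : ℕ) * d = k / (k + 1) * d := by push_cast; ring
    rw [hk]
    have hsub : ∀ a, (w a).1 ∈ convexHull ℝ (Set.range fun j => (v j).1) := fun a =>
      convexHull_mono (by rintro _ ⟨j, rfl⟩; exact ⟨_, rfl⟩) (hw1 a)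
    have hb : ∀ a, dist (w a) (bary v) ≤ k / (k + 1) * d := fun a =>
      convexHull_min (t := Metric.closedBall (bary v).1 (k / (k + 1) * d))
        (by rintro _ ⟨j, rfl⟩; exact dist_bary_le v hv j) (convex_closedBall _ _) (hsub a)
    have hmono : ((k : ℝ) - 1) / k * d ≤ k / (k + 1) * d := by
      refine mul_le_mul_of_nonneg_right ?_ hd
      rcases Nat.eq_zero_or_pos k with rfl | hk
      · simp
      · have : (0 : ℝ) < k := by exact_mod_cast hk
        rw [div_le_div_iff₀ this (by positivity)]
        nlinarith
    constructor
    · intro a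
      cases a using Fin.cases with
      | zero =>
        exact affine_mem_of_convex (convex_convexHull ℝ _)
          (fun j => subset_convexHull ℝ _ (Set.mem_range_self j)) _
      | succ a => exact hsub a
    · intro a b
      cases a using Fin.cases with
      | zero =>
        cases b using Fin.cases with
        | zero => simpa using by positivity
        | succ b => rw [dist_comm]; exact hb b
      | succ a =>
        cases b using Fin.cases with
        | zero => exact hb a
        | succ b => exact (hw2 a b).trans hmono

/-- The simplices of an iterated barycentric subdivision become arbitrarily small. -/
theorem exists_iterate_sd_small (v : Fin k → stdSimplex ℝ (Fin m)) {ε : ℝ} (hε : 0 < ε) :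
    ∃ j, (sd K bary k)^[j] (of K v) ∈
      Finsupp.supported K K {w : Fin k → stdSimplex ℝ (Fin m) | ∀ a b, dist (w a) (w b) < ε} := by
  obtain ⟨D, hD⟩ : ∃ D : ℝ, ∀ x y : stdSimplex ℝ (Fin m), dist x y ≤ D := by
    obtain ⟨D, hD⟩ := Metric.isBounded_iff.1 (isCompact_univ (X := stdSimplex ℝ (Fin m))).isBounded
    exact ⟨D, fun x y => hD (Set.mem_univ x) (Set.mem_univ y)⟩
  set r : ℝ := (k - 1 : ℝ) / k with hr
  rcases Nat.eq_zero_or_pos k with rfl | hk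
  · exact ⟨0, Finsupp.single_mem_supported K 1 fun a => a.elim0⟩
  have hk' : (1 : ℝ) ≤ k := by exact_mod_cast hk
  have hr0 : 0 ≤ r := div_nonneg (by linarith) (by linarith)
  have hr1 : r < 1 := by rw [hr, div_lt_one (by linarith)]; linarith
  have key : ∀ j, (sd K bary k)^[j] (of K v) ∈ Finsupp.supported K K
      {w : Fin k → stdSimplex ℝ (Fin m) | ∀ a b, dist (w a) (w b) ≤ r ^ j * D} := by
    intro j
    induction j with
    | zero => exact Finsupp.single_mem_supported K 1 fun a b => by simpa using hD _ _
    | succ j ih =>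
      rw [Function.iterate_succ_apply', ← Submodule.mem_comap]
      refine Set.mem_of_mem_of_subset ih ?_
      rw [SetLike.coe_subset_coe, Finsupp.supported_eq_span_single, Submodule.span_le]
      rintro _ ⟨w, hw, rfl⟩
      refine Finsupp.supported_mono ?_ (sd_mem_smallIn (K := K) w hw)
      rintro u ⟨-, hu⟩ a b
      rw [pow_succ', mul_assoc]
      exact hu a b
  have hlim : Filter.Tendsto (fun j : ℕ => r ^ j * D) Filter.atTop (nhds 0) := by
    simpa using (tendsto_pow_atTop_nhds_zero_of_lt_one hr0 hr1).mul_const D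
  obtain ⟨j, hj⟩ := (hlim.eventually (gt_mem_nhds hε)).exists
  exact ⟨j, Finsupp.supported_mono (fun w hw a b => (hw a b).trans_lt hj) (key j)⟩

end SimplexAffine

end

/-! ### Singular chains and barycentric subdivision -/

noncomputable section

namespace SingularChain

open SimplexAffine

variable (K : Type*) [Field K] {X Y : Type*} [TopologicalSpace X] [TopologicalSpace Y]

/-- Singular chains of `X`, indexed by the number `k` of vertices of a simplex (so `k` is one more
than the usual degree). For `k = 0` the standard simplex is empty, which makes this the augmented
singular chain complex. -/
abbrev Chain (X : Type*) [TopologicalSpace X] (k : ℕ) : Type _ :=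
  C(stdSimplex ℝ (Fin k), X) →₀ K

/-- The chain consisting of one simplex. -/
abbrev of {k : ℕ} (σ : C(stdSimplex ℝ (Fin k), X)) : Chain K X k := Finsupp.single σ 1

/-- The chains on the simplices with image in `S`. -/
def chainsIn (S : Set X) (k : ℕ) : Submodule K (Chain K X k) :=
  Finsupp.supported K K {σ | ∀ t, σ t ∈ S}

/-- The singular chain obtained from affine simplices in `Δ^{m-1}` by composition with `σ`. -/
def push {m : ℕ} (σ : C(stdSimplex ℝ (Fin m), X)) (k : ℕ) :
    TupleChain.Chain K (stdSimplex ℝ (Fin m)) k →ₗ[K] Chain K X k :=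
  Finsupp.lmapDomain K K fun v => σ.comp (affine v)

/-- The tautological affine simplex of `Δ^{k-1}`. -/
abbrev universalSimplex (k : ℕ) : TupleChain.Chain K (stdSimplex ℝ (Fin k)) k :=
  TupleChain.of K stdSimplex.vertex

/-- The natural operation on singular chains given by an affine chain of the standard simplex. -/
def natural {k l : ℕ} (c : TupleChain.Chain K (stdSimplex ℝ (Fin k)) l) :
    Chain K X k →ₗ[K] Chain K X l :=
  Finsupp.linearCombination K fun σ => push K σ l c

/-- The augmented boundary of singular chains. -/
def boundary (k : ℕ) : Chain K X (k + 1) →ₗ[K] Chain K X k :=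
  natural K (TupleChain.boundary K k (universalSimplex K (k + 1)))

/-- Barycentric subdivision. -/
def sd (k : ℕ) : Chain K X k →ₗ[K] Chain K X k :=
  natural K (TupleChain.sd K bary k (universalSimplex K k))

/-- The chain homotopy from the identity to barycentric subdivision. -/
def sdHomotopy (k : ℕ) : Chain K X k →ₗ[K] Chain K X (k + 1) :=
  natural K (TupleChain.sdHomotopy K bary k (universalSimplex K k))

/-- The map of chains induced by a continuous map. -/
def map (f : C(X, Y)) (k : ℕ) : Chain K X k →ₗ[K] Chain K Y k :=
  Finsupp.lmapDomain K K fun σ => f.comp σ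

variable {K}

theorem ext_of {M : Type*} [AddCommGroup M] [Module K M] {k : ℕ} {φ ψ : Chain K X k →ₗ[K] M}
    (h : ∀ σ, φ (of K σ) = ψ (of K σ)) : φ = ψ :=
  Finsupp.lhom_ext' fun v => LinearMap.ext_ring (h v)

theorem push_of {k m : ℕ} (σ : C(stdSimplex ℝ (Fin m), X)) (v : Fin k → stdSimplex ℝ (Fin m)) :
    push K σ k (TupleChain.of K v) = of K (σ.comp (affine v)) := by
  simp [push, of]

theorem push_universalSimplex {k : ℕ} (σ : C(stdSimplex ℝ (Fin k), X)) :
    push K σ k (universalSimplex K k) = of K σ := by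
  rw [push_of, affine_vertex, ContinuousMap.comp_id]

theorem natural_of {k l : ℕ} (c : TupleChain.Chain K (stdSimplex ℝ (Fin k)) l)
    (σ : C(stdSimplex ℝ (Fin k), X)) : natural K c (of K σ) = push K σ l c := by
  simp [natural, of]

theorem map_of {k : ℕ} (f : C(X, Y)) (σ : C(stdSimplex ℝ (Fin k), X)) :
    map K f k (of K σ) = of K (f.comp σ) := by
  simp [map, of]

theorem push_comp_affine {k l m : ℕ} (σ : C(stdSimplex ℝ (Fin m), X))
    (v : Fin l → stdSimplex ℝ (Fin m)) (c : TupleChain.Chain K (stdSimplex ℝ (Fin l)) k) :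
    push K (σ.comp (affine v)) k c = push K σ k (TupleChain.map K (affine v) k c) := by
  suffices h : push K (σ.comp (affine v)) k = push K σ k ∘ₗ TupleChain.map K (affine v) k from
    LinearMap.congr_fun h c
  refine TupleChain.ext_of fun w => ?_
  rw [LinearMap.comp_apply, TupleChain.map_of, push_of, push_of, ContinuousMap.comp_assoc,
    ← affine_affine]
  rfl

theorem map_push {k m : ℕ} (f : C(X, Y)) (σ : C(stdSimplex ℝ (Fin m), X))
    (c : TupleChain.Chain K (stdSimplex ℝ (Fin m)) k) :
    map K f k (push K σ k c) = push K (f.comp σ) k c := by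
  suffices h : map K f k ∘ₗ push K σ k = push K (f.comp σ) k from LinearMap.congr_fun h c
  refine TupleChain.ext_of fun w => ?_
  rw [LinearMap.comp_apply, push_of, push_of, map_of, ContinuousMap.comp_assoc]

theorem map_natural {k l : ℕ} (f : C(X, Y)) (c : TupleChain.Chain K (stdSimplex ℝ (Fin k)) l)
    (z : Chain K X k) : map K f l (natural K c z) = natural K c (map K f k z) := by
  suffices h : map K f l ∘ₗ natural K c = natural K c ∘ₗ map K f k from LinearMap.congr_fun h z
  refine ext_of fun σ => ?_
  rw [LinearMap.comp_apply, LinearMap.comp_apply, natural_of, map_of, natural_of, map_push]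

theorem map_boundary {k : ℕ} (f : C(X, Y)) (z : Chain K X (k + 1)) :
    map K f k (boundary K k z) = boundary K k (map K f (k + 1) z) :=
  map_natural f _ z

/-- A natural operation on singular chains restricts to the corresponding one on affine chains. -/
theorem natural_push {k l m : ℕ}
    {Φ : ∀ {m : ℕ}, TupleChain.Chain K (stdSimplex ℝ (Fin m)) k →ₗ[K]
      TupleChain.Chain K (stdSimplex ℝ (Fin m)) l}
    (hΦ : ∀ {m n : ℕ} (v : Fin m → stdSimplex ℝ (Fin n)) (z),
      TupleChain.map K (affine v) l (Φ z) = Φ (TupleChain.map K (affine v) k z))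
    (σ : C(stdSimplex ℝ (Fin m), X)) (z : TupleChain.Chain K (stdSimplex ℝ (Fin m)) k) :
    natural K (Φ (universalSimplex K k)) (push K σ k z) = push K σ l (Φ z) := by
  suffices h : natural K (Φ (universalSimplex K k)) ∘ₗ push K σ k = push K σ l ∘ₗ Φ from
    LinearMap.congr_fun h z
  refine TupleChain.ext_of fun w => ?_
  rw [LinearMap.comp_apply, LinearMap.comp_apply, push_of, natural_of, push_comp_affine, hΦ,
    TupleChain.map_of]
  congr 3
  funext i
  exact affine_vertex_apply w i

theorem boundary_push {k m : ℕ} (σ : C(stdSimplex ℝ (Fin m), X))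
    (z : TupleChain.Chain K (stdSimplex ℝ (Fin m)) (k + 1)) :
    boundary K k (push K σ (k + 1) z) = push K σ k (TupleChain.boundary K k z) :=
  natural_push (Φ := TupleChain.boundary K k) (fun v z => TupleChain.map_boundary (affine v) z) σ z

theorem sd_push {k m : ℕ} (σ : C(stdSimplex ℝ (Fin m), X))
    (z : TupleChain.Chain K (stdSimplex ℝ (Fin m)) k) :
    sd K k (push K σ k z) = push K σ k (TupleChain.sd K bary k z) :=
  natural_push (Φ := TupleChain.sd K bary k) (fun v z => TupleChain.map_sd (affine_bary v) z) σ z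

theorem sdHomotopy_push {k m : ℕ} (σ : C(stdSimplex ℝ (Fin m), X))
    (z : TupleChain.Chain K (stdSimplex ℝ (Fin m)) k) :
    sdHomotopy K k (push K σ k z) = push K σ (k + 1) (TupleChain.sdHomotopy K bary k z) :=
  natural_push (Φ := TupleChain.sdHomotopy K bary k)
    (fun v z => TupleChain.map_sdHomotopy (affine_bary v) z) σ z

theorem boundary_boundary {k : ℕ} (z : Chain K X (k + 2)) :
    boundary K k (boundary K (k + 1) z) = 0 := by
  suffices h : boundary K k ∘ₗ boundary K (k + 1) = (0 : Chain K X (k + 2) →ₗ[K] _) from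
    LinearMap.congr_fun h z
  refine ext_of fun σ => ?_
  rw [LinearMap.comp_apply, ← push_universalSimplex, boundary_push, boundary_push,
    TupleChain.boundary_boundary, map_zero, LinearMap.zero_apply]

theorem boundary_sd {k : ℕ} (z : Chain K X (k + 1)) :
    boundary K k (sd K (k + 1) z) = sd K k (boundary K k z) := by
  suffices h : boundary K k ∘ₗ sd K (k + 1) = sd K k ∘ₗ boundary K k from LinearMap.congr_fun h z
  refine ext_of fun σ => ?_
  rw [LinearMap.comp_apply, LinearMap.comp_apply, ← push_universalSimplex, sd_push, boundary_push,
    boundary_push, sd_push, TupleChain.boundary_sd]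

theorem boundary_sdHomotopy {k : ℕ} (z : Chain K X (k + 1)) :
    boundary K (k + 1) (sdHomotopy K (k + 1) z) =
      z - sd K (k + 1) z - sdHomotopy K k (boundary K k z) := by
  suffices h : boundary K (k + 1) ∘ₗ sdHomotopy K (k + 1) =
      LinearMap.id - sd K (k + 1) - sdHomotopy K k ∘ₗ boundary K k from LinearMap.congr_fun h z
  refine ext_of fun σ => ?_
  simp only [LinearMap.comp_apply, LinearMap.sub_apply, LinearMap.id_apply]
  rw [← push_universalSimplex, sdHomotopy_push, boundary_push, boundary_push, sd_push,
    sdHomotopy_push, TupleChain.boundary_sdHomotopy, map_sub, map_sub]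

/-! ### Chains in a subset -/

theorem of_mem_chainsIn {S : Set X} {k : ℕ} {σ : C(stdSimplex ℝ (Fin k), X)} (h : ∀ t, σ t ∈ S) :
    of K σ ∈ chainsIn K S k :=
  Finsupp.single_mem_supported K 1 h

theorem chainsIn_le {S : Set X} {k : ℕ} {p : Submodule K (Chain K X k)} :
    chainsIn K S k ≤ p ↔ ∀ σ : C(stdSimplex ℝ (Fin k), X), (∀ t, σ t ∈ S) → of K σ ∈ p := by
  rw [chainsIn, Finsupp.supported_eq_span_single, Submodule.span_le, Set.image_subset_iff]
  rfl

theorem chainsIn_mono {S T : Set X} (h : S ⊆ T) (k : ℕ) : chainsIn K S k ≤ chainsIn K T k :=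
  Finsupp.supported_mono fun _ hσ t => h (hσ t)

theorem chainsIn_inter (S T : Set X) (k : ℕ) :
    chainsIn K (S ∩ T) k = chainsIn K S k ⊓ chainsIn K T k := by
  rw [chainsIn, chainsIn, chainsIn, ← Finsupp.supported_inter]
  congr 1
  ext σ
  exact forall_and

/-- There is only the empty simplex without vertices, and it lies in every subset. -/
theorem chainsIn_zero (S : Set X) : chainsIn K S 0 = ⊤ := by
  rw [chainsIn, ← Finsupp.supported_univ]
  congr 1
  refine Set.eq_univ_of_forall fun σ t => ?_
  simpa using t.2.2

theorem chainsIn_univ (k : ℕ) : chainsIn K (Set.univ : Set X) k = ⊤ := by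
  rw [chainsIn, ← Finsupp.supported_univ]
  congr 1
  exact Set.eq_univ_of_forall fun σ t => Set.mem_univ _

theorem push_mem_chainsIn {S : Set X} {k m : ℕ} {σ : C(stdSimplex ℝ (Fin m), X)}
    (h : ∀ t, σ t ∈ S) (c : TupleChain.Chain K (stdSimplex ℝ (Fin m)) k) :
    push K σ k c ∈ chainsIn K S k := by
  induction c using Finsupp.induction_linear with
  | zero => rw [map_zero]; exact zero_mem _
  | add c d hc hd => rw [map_add]; exact add_mem hc hd
  | single v a =>
    rw [← mul_one a, ← smul_eq_mul, ← Finsupp.smul_single, map_smul, push_of]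
    exact Submodule.smul_mem _ _ (of_mem_chainsIn fun t => h _)

theorem natural_mem_chainsIn {S : Set X} {k l : ℕ}
    (c : TupleChain.Chain K (stdSimplex ℝ (Fin k)) l) {z : Chain K X k}
    (hz : z ∈ chainsIn K S k) : natural K c z ∈ chainsIn K S l := by
  rw [← Submodule.mem_comap]
  refine chainsIn_le.2 (fun σ hσ => ?_) hz
  rw [Submodule.mem_comap, natural_of]
  exact push_mem_chainsIn hσ c

theorem boundary_mem {S : Set X} {k : ℕ} {z : Chain K X (k + 1)}
    (hz : z ∈ chainsIn K S (k + 1)) : boundary K k z ∈ chainsIn K S k :=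
  natural_mem_chainsIn _ hz

theorem sd_mem {S : Set X} {k : ℕ} {z : Chain K X k} (hz : z ∈ chainsIn K S k) :
    sd K k z ∈ chainsIn K S k :=
  natural_mem_chainsIn _ hz

theorem sdHomotopy_mem {S : Set X} {k : ℕ} {z : Chain K X k} (hz : z ∈ chainsIn K S k) :
    sdHomotopy K k z ∈ chainsIn K S (k + 1) :=
  natural_mem_chainsIn _ hz

theorem iterate_sd_mem_sup {P Q : Set X} {k : ℕ} {z : Chain K X k}
    (hz : z ∈ chainsIn K P k ⊔ chainsIn K Q k) (j : ℕ) :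
    (sd K k)^[j] z ∈ chainsIn K P k ⊔ chainsIn K Q k := by
  induction j with
  | zero => exact hz
  | succ j ih =>
    obtain ⟨p, hp, q, hq, h⟩ := Submodule.mem_sup.1 ih
    rw [Function.iterate_succ_apply', ← h, map_add]
    exact add_mem (Submodule.mem_sup_left (sd_mem hp)) (Submodule.mem_sup_right (sd_mem hq))

theorem iterate_sd_push {k m : ℕ} (σ : C(stdSimplex ℝ (Fin m), X))
    (z : TupleChain.Chain K (stdSimplex ℝ (Fin m)) k) (j : ℕ) :
    (sd K k)^[j] (push K σ k z) = push K σ k ((TupleChain.sd K bary k)^[j] z) := by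
  induction j with
  | zero => rfl
  | succ j ih => rw [Function.iterate_succ_apply', Function.iterate_succ_apply', ih, sd_push]

/-- An iterated barycentric subdivision of a simplex in `P ∪ Q` is a sum of simplices each of
which lies in `P` or in `Q`, by Lebesgue's number lemma. -/
theorem exists_iterate_sd_of_mem {P Q : Set X} (hP : IsOpen P) (hQ : IsOpen Q) {k : ℕ}
    (σ : C(stdSimplex ℝ (Fin k), X)) (hσ : ∀ t, σ t ∈ P ∪ Q) :
    ∃ j, (sd K k)^[j] (of K σ) ∈ chainsIn K P k ⊔ chainsIn K Q k := by
  rcases Nat.eq_zero_or_pos k with rfl | hk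
  · exact ⟨0, by rw [chainsIn_zero, top_sup_eq]; trivial⟩
  obtain ⟨ε, hε, hball⟩ := lebesgue_number_lemma_of_metric
    (isCompact_univ (X := stdSimplex ℝ (Fin k))) (c := fun b : Bool => σ ⁻¹' (cond b P Q))
    (by rintro (_ | _); exacts [hQ.preimage σ.continuous, hP.preimage σ.continuous])
    (fun t _ => by
      rcases hσ t with h | h
      exacts [Set.mem_iUnion.2 ⟨true, h⟩, Set.mem_iUnion.2 ⟨false, h⟩])
  obtain ⟨j, hj⟩ := exists_iterate_sd_small (K := K)
    (stdSimplex.vertex (S := ℝ) (X := Fin k)) hε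
  refine ⟨j, ?_⟩
  rw [← push_universalSimplex, iterate_sd_push, ← Submodule.mem_comap]
  refine Set.mem_of_mem_of_subset hj ?_
  rw [SetLike.coe_subset_coe, Finsupp.supported_eq_span_single, Submodule.span_le]
  rintro _ ⟨w, hw, rfl⟩
  rw [SetLike.mem_coe, Submodule.mem_comap, push_of]
  have hsub : ∀ t, affine w t ∈ Metric.ball (w ⟨0, hk⟩) ε := fun t =>
    affine_mem_of_convex (S := Metric.ball (w ⟨0, hk⟩).1 ε) (convex_ball _ _)
      (fun i => hw i ⟨0, hk⟩) t
  obtain ⟨b, hb⟩ := hball (w ⟨0, hk⟩) (Set.mem_univ _)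
  cases b with
  | true => exact Submodule.mem_sup_left (of_mem_chainsIn fun t => hb (hsub t))
  | false => exact Submodule.mem_sup_right (of_mem_chainsIn fun t => hb (hsub t))

/-- An iterated barycentric subdivision of a chain in `P ∪ Q` is a sum of a chain in `P` and a
chain in `Q`. -/
theorem exists_iterate_sd {P Q : Set X} (hP : IsOpen P) (hQ : IsOpen Q) {k : ℕ} {z : Chain K X k}
    (hz : z ∈ chainsIn K (P ∪ Q) k) :
    ∃ j, (sd K k)^[j] z ∈ chainsIn K P k ⊔ chainsIn K Q k := by
  rw [chainsIn, Finsupp.supported_eq_span_single] at hz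
  induction hz using Submodule.span_induction with
  | mem x h =>
    obtain ⟨σ, hσ, rfl⟩ := h
    exact exists_iterate_sd_of_mem hP hQ σ hσ
  | zero => exact ⟨0, zero_mem _⟩
  | add x y _ _ hx hy =>
    obtain ⟨i, hi⟩ := hx
    obtain ⟨j, hj⟩ := hy
    refine ⟨i + j, ?_⟩
    rw [iterate_map_add]
    refine add_mem ?_ ?_
    · rw [add_comm, Function.iterate_add_apply]
      exact iterate_sd_mem_sup hi j
    · rw [Function.iterate_add_apply]
      exact iterate_sd_mem_sup hj i
  | smul a x _ hx =>
    obtain ⟨j, hj⟩ := hx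
    refine ⟨j, ?_⟩
    rw [← Module.End.pow_apply, map_smul, Module.End.pow_apply]
    exact Submodule.smul_mem _ _ hj

theorem chainsIn_empty (k : ℕ) : chainsIn K (∅ : Set X) (k + 1) = ⊥ := by
  rw [eq_bot_iff, chainsIn_le]
  exact fun σ hσ => (hσ (stdSimplex.vertex 0)).elim

/-- A chain in `P ∪ Q` with boundary in `T` is the sum of a chain in `P` and a chain in `Q`, up to
a boundary in `P ∪ Q` and a chain in `T`. -/
theorem exists_decomposition {P Q T : Set X} (hP : IsOpen P) (hQ : IsOpen Q) {k : ℕ}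
    {z : Chain K X (k + 1)} (hz : z ∈ chainsIn K (P ∪ Q) (k + 1))
    (hT : boundary K k z ∈ chainsIn K T k) :
    ∃ p ∈ chainsIn K P (k + 1), ∃ q ∈ chainsIn K Q (k + 1),
      ∃ w ∈ chainsIn K (P ∪ Q) (k + 2), ∃ t ∈ chainsIn K T (k + 1),
        z = p + q + boundary K (k + 1) w + t := by
  have key : ∀ j, boundary K k ((sd K (k + 1))^[j] z) ∈ chainsIn K T k ∧
      (sd K (k + 1))^[j] z ∈ chainsIn K (P ∪ Q) (k + 1) ∧
      ∃ w ∈ chainsIn K (P ∪ Q) (k + 2), ∃ t ∈ chainsIn K T (k + 1),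
        z = (sd K (k + 1))^[j] z + boundary K (k + 1) w + t := by
    intro j
    induction j with
    | zero => exact ⟨hT, hz, 0, zero_mem _, 0, zero_mem _, by simp⟩
    | succ j ih =>
      obtain ⟨hb, hm, w, hw, t, ht, h⟩ := ih
      rw [Function.iterate_succ_apply']
      set y := (sd K (k + 1))^[j] z
      refine ⟨by rw [boundary_sd]; exact sd_mem hb, sd_mem hm, w + sdHomotopy K (k + 1) y,
        add_mem hw (sdHomotopy_mem hm), t + sdHomotopy K k (boundary K k y),
        add_mem ht (sdHomotopy_mem hb), ?_⟩
      rw [map_add, boundary_sdHomotopy]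
      conv_lhs => rw [h]
      abel
  obtain ⟨j, hj⟩ := exists_iterate_sd hP hQ hz
  obtain ⟨p, hp, q, hq, hpq⟩ := Submodule.mem_sup.1 hj
  obtain ⟨-, -, w, hw, t, ht, h⟩ := key j
  exact ⟨p, hp, q, hq, w, hw, t, ht, by rw [hpq]; exact h⟩

end SingularChain

end

/-! ### Acyclic subsets -/

noncomputable section

namespace SingularChain

open SimplexAffine

variable {K : Type*} [Field K] {X Y : Type*} [TopologicalSpace X] [TopologicalSpace Y]

/-- Cycles of the augmented complex; every chain of empty simplices is one. -/
def IsCycle : {k : ℕ} → Chain K X k → Prop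
  | 0, _ => True
  | k + 1, z => boundary K k z = 0

theorem isCycle_boundary {k : ℕ} (z : Chain K X (k + 1)) : IsCycle (boundary K k z) := by
  cases k with
  | zero => trivial
  | succ k => exact boundary_boundary z

variable (K) in
/-- The reduced homology of `S` vanishes in degrees less than `d - 1`, that is, on simplices with
fewer than `d` vertices. For `d = 1` this says that `S` is nonempty. -/
def AcyclicBelow (S : Set X) (d : ℕ) : Prop :=
  ∀ k < d, ∀ z ∈ chainsIn K S k, IsCycle z → ∃ w ∈ chainsIn K S (k + 1), boundary K k w = z

/-- The Mayer–Vietoris argument. -/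
theorem AcyclicBelow.union {P Q : Set X} (hP : IsOpen P) (hQ : IsOpen Q) {d : ℕ}
    (aP : AcyclicBelow K P (d + 1)) (aQ : AcyclicBelow K Q (d + 1))
    (aPQ : AcyclicBelow K (P ∩ Q) d) : AcyclicBelow K (P ∪ Q) (d + 1) := by
  have mP := fun k => chainsIn_mono (K := K) (Set.subset_union_left (s := P) (t := Q)) k
  have mQ := fun k => chainsIn_mono (K := K) (Set.subset_union_right (s := P) (t := Q)) k
  intro k hk z hz hc
  cases k with
  | zero =>
    obtain ⟨w, hw, h⟩ := aP 0 (by omega) z (by rw [chainsIn_zero]; trivial) hc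
    exact ⟨w, mP _ hw, h⟩
  | succ k =>
    have hc : boundary K k z = 0 := hc
    obtain ⟨p, hp, q, hq, w, hw, t, ht, h⟩ :=
      exists_decomposition (T := ∅) hP hQ hz (by rw [hc]; exact zero_mem _)
    rw [chainsIn_empty, Submodule.mem_bot] at ht
    subst ht
    have hpq : boundary K k p = -boundary K k q := by
      rw [h, add_zero, map_add, map_add, boundary_boundary, add_zero] at hc
      exact eq_neg_of_add_eq_zero_left hc
    have hy : boundary K k p ∈ chainsIn K (P ∩ Q) k := by
      rw [chainsIn_inter]
      exact ⟨boundary_mem hp, by rw [hpq]; exact neg_mem (boundary_mem hq)⟩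
    obtain ⟨v, hv, hvp⟩ := aPQ k (by omega) _ hy (isCycle_boundary p)
    rw [chainsIn_inter] at hv
    obtain ⟨a, ha, hap⟩ := aP (k + 1) hk (p - v) (sub_mem hp hv.1)
      (show boundary K k _ = 0 by rw [map_sub, hvp, sub_self])
    obtain ⟨c, hc, hcq⟩ := aQ (k + 1) hk (q + v) (add_mem hq hv.2)
      (show boundary K k _ = 0 by rw [map_add, hvp, hpq, add_neg_cancel])
    refine ⟨a + c + w, add_mem (add_mem (mP _ ha) (mQ _ hc)) hw, ?_⟩
    rw [map_add, map_add, hap, hcq, h]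
    abel

/-- An embedding gives a bijection between the simplices in `S` and those in its image. -/
theorem AcyclicBelow.image {e : X → Y} (he : Topology.IsEmbedding e) {S : Set X} {d : ℕ}
    (h : AcyclicBelow K S d) : AcyclicBelow K (e '' S) d := by
  let f : C(X, Y) := ⟨e, he.continuous⟩
  have hmap : ∀ k, chainsIn K (e '' S) k = (chainsIn K S k).map (map K f k) := by
    intro k
    rw [map, chainsIn, chainsIn, Finsupp.lmapDomain_supported]
    congr 1
    ext τ
    constructor
    · intro hτ
      choose g hg using hτ
      refine ⟨⟨g, he.continuous_iff.2 ?_⟩, fun t => (hg t).1, ?_⟩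
      · convert τ.continuous using 1
        funext t
        exact (hg t).2
      · ext t
        exact (hg t).2
    · rintro ⟨σ, hσ, rfl⟩ t
      exact ⟨σ t, hσ t, rfl⟩
  have hinj : ∀ k, Function.Injective (map K f k : Chain K X k → Chain K Y k) := by
    intro k
    refine Finsupp.mapDomain_injective fun σ τ hστ => ?_
    ext t
    exact he.injective (DFunLike.congr_fun hστ t)
  intro k hk z hz hc
  rw [hmap] at hz
  obtain ⟨y, hy, rfl⟩ := hz
  have hyc : IsCycle y := by
    cases k with
    | zero => trivial
    | succ k =>
      refine hinj k ?_
      rw [map_boundary, map_zero]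
      exact hc
  obtain ⟨w, hw, rfl⟩ := h k hk y hy hyc
  exact ⟨map K f (k + 1) w, by rw [hmap]; exact ⟨w, hw, rfl⟩, (map_boundary f w).symm⟩

/-! ### Faces and cones of singular simplices -/

/-- The face of `Δᵏ` opposite to the `i`-th vertex. -/
def face {k : ℕ} (i : Fin (k + 1)) : C(stdSimplex ℝ (Fin k), stdSimplex ℝ (Fin (k + 1))) :=
  affine (stdSimplex.vertex ∘ i.succAbove)

theorem face_apply_self {k : ℕ} (i : Fin (k + 1)) (t : stdSimplex ℝ (Fin k)) : face i t i = 0 := by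
  rw [face, affine_apply]
  exact Finset.sum_eq_zero fun j _ => by simp

theorem face_apply_succAbove {k : ℕ} (i : Fin (k + 1)) (t : stdSimplex ℝ (Fin k)) (j : Fin k) :
    face i t (i.succAbove j) = t j := by
  simp [face, affine_apply, Pi.single_apply]

theorem boundary_of {k : ℕ} (σ : C(stdSimplex ℝ (Fin (k + 1)), X)) :
    boundary K k (of K σ) = ∑ i : Fin (k + 1), (-1 : K) ^ (i : ℕ) • of K (σ.comp (face i)) := by
  rw [boundary, natural_of, TupleChain.boundary_of, map_sum]
  refine Finset.sum_congr rfl fun i _ => ?_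
  rw [map_smul, push_of, face]

/-- The projection of a point of `Δᵏ` other than the vertex `0` to the face opposite to it. -/
def projectFace {k : ℕ} (t : stdSimplex ℝ (Fin (k + 1))) (h : t 0 < 1) : stdSimplex ℝ (Fin k) :=
  ⟨fun j => (1 - t 0)⁻¹ * t j.succ,
    fun j => mul_nonneg (inv_nonneg.2 (by linarith)) (stdSimplex.zero_le t _), by
      rw [← Finset.mul_sum]
      have h1 : t 0 + ∑ j : Fin k, t j.succ = 1 := by
        rw [← Fin.sum_univ_succ]
        exact t.2.2
      rw [show ∑ j : Fin k, t j.succ = 1 - t 0 by linarith]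
      exact inv_mul_cancel₀ (by linarith)⟩

theorem projectFace_apply {k : ℕ} (t : stdSimplex ℝ (Fin (k + 1))) (h : t 0 < 1) (j : Fin k) :
    projectFace t h j = (1 - t 0)⁻¹ * t j.succ := rfl

theorem face_succ_apply_zero {k : ℕ} (i : Fin (k + 1)) (t : stdSimplex ℝ (Fin (k + 1))) :
    face i.succ t 0 = t 0 := by
  have h := face_apply_succAbove i.succ t 0
  rwa [Fin.succ_succAbove_zero] at h

theorem projectFace_face_zero {k : ℕ} (t : stdSimplex ℝ (Fin k)) (h : face 0 t 0 < 1) :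
    projectFace (face 0 t) h = t := by
  ext j
  have h1 := face_apply_succAbove 0 t j
  rw [Fin.succAbove_zero] at h1
  rw [projectFace_apply, h1, face_apply_self, sub_zero, inv_one, one_mul]

theorem projectFace_face_succ {k : ℕ} (i : Fin (k + 1)) (t : stdSimplex ℝ (Fin (k + 1)))
    (h : face i.succ t 0 < 1) (h' : t 0 < 1) :
    projectFace (face i.succ t) h = face i (projectFace t h') := by
  ext j
  rw [projectFace_apply, face_succ_apply_zero]
  rcases Fin.eq_self_or_eq_succAbove i j with rfl | ⟨l, rfl⟩
  · rw [face_apply_self, face_apply_self, mul_zero]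
  · have h1 := face_apply_succAbove i.succ t l.succ
    rw [Fin.succ_succAbove_succ] at h1
    rw [h1, face_apply_succAbove, projectFace_apply]

variable {E : Type*} [NormedAddCommGroup E] [NormedSpace ℝ E]

/-- The cone with apex `b` over a singular simplex of a normed space. -/
def coneSimplex (b : E) {k : ℕ} (σ : C(stdSimplex ℝ (Fin k), E)) :
    C(stdSimplex ℝ (Fin (k + 1)), E) where
  toFun t := if h : t 0 < 1 then t 0 • b + (1 - t 0) • σ (projectFace t h) else b
  continuous_toFun := by
    have hcoord : ∀ j, Continuous fun t : stdSimplex ℝ (Fin (k + 1)) => t j := fun j =>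
      (continuous_apply j).comp continuous_subtype_val
    obtain ⟨M, hM⟩ : ∃ M, ∀ s, ‖σ s - b‖ ≤ M := by
      obtain ⟨M, hM⟩ := (isCompact_range
        (σ - ContinuousMap.const _ b).continuous).isBounded.exists_norm_le
      exact ⟨M, fun s => hM _ ⟨s, rfl⟩⟩
    rw [continuous_iff_continuousAt]
    intro t
    by_cases ht : t 0 < 1
    · have hopen : IsOpen {t : stdSimplex ℝ (Fin (k + 1)) | t 0 < 1} :=
        isOpen_lt (hcoord 0) continuous_const
      refine (hopen.isOpenEmbedding_subtypeVal.continuousAt_iff (x := ⟨t, ht⟩)).1 ?_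
      refine Continuous.continuousAt ?_
      have heq : ((fun t : stdSimplex ℝ (Fin (k + 1)) =>
            if h : t 0 < 1 then t 0 • b + (1 - t 0) • σ (projectFace t h) else b) ∘
            (Subtype.val : {t : stdSimplex ℝ (Fin (k + 1)) | t 0 < 1} → _)) =
          fun s => s.1 0 • b + (1 - s.1 0) • σ (projectFace s.1 s.2) := by
        funext s
        exact dif_pos s.2
      rw [heq]
      have h0 : Continuous fun s : {t : stdSimplex ℝ (Fin (k + 1)) | t 0 < 1} => s.1 0 :=
        (hcoord 0).comp continuous_subtype_val
      have hp : Continuous fun s : {t : stdSimplex ℝ (Fin (k + 1)) | t 0 < 1} =>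
          projectFace s.1 s.2 := by
        refine Continuous.subtype_mk (continuous_pi fun j => ?_) _
        refine ((continuous_const.sub h0).inv₀ fun s => ?_).mul
          ((hcoord j.succ).comp continuous_subtype_val)
        exact (sub_pos.2 (show s.1 0 < 1 from s.2)).ne'
      fun_prop
    · have ht1 : t 0 = 1 := le_antisymm (stdSimplex.le_one t 0) (not_lt.1 ht)
      rw [ContinuousAt, dif_neg ht, tendsto_iff_norm_sub_tendsto_zero]
      have hlim : Filter.Tendsto (fun s : stdSimplex ℝ (Fin (k + 1)) => (1 - s 0) * M) (nhds t)
          (nhds 0) := by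
        have hc : Continuous fun s : stdSimplex ℝ (Fin (k + 1)) => (1 - s 0) * M :=
          (continuous_const.sub (hcoord 0)).mul continuous_const
        have h := hc.tendsto t
        rwa [ht1, sub_self, zero_mul] at h
      refine squeeze_zero (fun _ => norm_nonneg _) (fun s => ?_) hlim
      split_ifs with hs
      · have : s 0 • b + (1 - s 0) • σ (projectFace s hs) - b =
            (1 - s 0) • (σ (projectFace s hs) - b) := by
          module
        rw [this, norm_smul, Real.norm_of_nonneg (by linarith)]
        exact mul_le_mul_of_nonneg_left (hM _) (by linarith)
      · have : s 0 = 1 := le_antisymm (stdSimplex.le_one s 0) (not_lt.1 hs)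
        simp [this]

theorem coneSimplex_apply (b : E) {k : ℕ} (σ : C(stdSimplex ℝ (Fin k), E))
    (t : stdSimplex ℝ (Fin (k + 1))) : coneSimplex b σ t =
      if h : t 0 < 1 then t 0 • b + (1 - t 0) • σ (projectFace t h) else b := rfl

theorem coneSimplex_comp_face_zero (b : E) {k : ℕ} (σ : C(stdSimplex ℝ (Fin k), E)) :
    (coneSimplex b σ).comp (face 0) = σ := by
  ext t
  have h : face 0 t 0 = 0 := face_apply_self 0 t
  rw [ContinuousMap.comp_apply, coneSimplex_apply, dif_pos (by rw [h]; exact one_pos),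
    projectFace_face_zero, h, zero_smul, zero_add, sub_zero, one_smul]

theorem coneSimplex_comp_face_succ (b : E) {k : ℕ} (σ : C(stdSimplex ℝ (Fin (k + 1)), E))
    (i : Fin (k + 1)) :
    (coneSimplex b σ).comp (face i.succ) = coneSimplex b (σ.comp (face i)) := by
  ext t
  rw [ContinuousMap.comp_apply, coneSimplex_apply, coneSimplex_apply]
  by_cases h : t 0 < 1
  · have h' : face i.succ t 0 < 1 := by rwa [face_succ_apply_zero]
    rw [dif_pos h, dif_pos h', projectFace_face_succ i t h' h, face_succ_apply_zero]
    rfl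
  · rw [dif_neg h, dif_neg (by rwa [face_succ_apply_zero])]

variable (K) in
/-- The cone operator on singular chains of a normed space. -/
def cone (b : E) (k : ℕ) : Chain K E k →ₗ[K] Chain K E (k + 1) :=
  Finsupp.lmapDomain K K (coneSimplex b)

theorem cone_of (b : E) {k : ℕ} (σ : C(stdSimplex ℝ (Fin k), E)) :
    cone K b k (of K σ) = of K (coneSimplex b σ) := by
  simp [cone, of]

theorem boundary_cone {b : E} {k : ℕ} {z : Chain K E k} (hz : IsCycle z) :
    boundary K k (cone K b k z) = z := by
  cases k with
  | zero =>
    suffices h : boundary K 0 ∘ₗ cone K b 0 = LinearMap.id from LinearMap.congr_fun h z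
    refine ext_of fun σ => ?_
    rw [LinearMap.comp_apply, cone_of, boundary_of, Fin.sum_univ_succ, coneSimplex_comp_face_zero]
    simp
  | succ k =>
    have h : boundary K (k + 1) ∘ₗ cone K b (k + 1) =
        LinearMap.id - cone K b k ∘ₗ boundary K k := by
      refine ext_of fun σ => ?_
      rw [LinearMap.comp_apply, cone_of, boundary_of, Fin.sum_univ_succ,
        coneSimplex_comp_face_zero, LinearMap.sub_apply, LinearMap.comp_apply, boundary_of,
        map_sum, sub_eq_add_neg, ← Finset.sum_neg_distrib]
      simp only [coneSimplex_comp_face_succ, map_smul, cone_of]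
      simp [pow_succ]
    have h1 := LinearMap.congr_fun h z
    have hz : boundary K k z = 0 := hz
    simpa [hz] using h1

theorem cone_mem {S : Set E} (hS : Convex ℝ S) {b : E} (hb : b ∈ S) {k : ℕ} {z : Chain K E k}
    (hz : z ∈ chainsIn K S k) : cone K b k z ∈ chainsIn K S (k + 1) := by
  rw [← Submodule.mem_comap]
  refine chainsIn_le.2 (fun σ hσ => ?_) hz
  rw [Submodule.mem_comap, cone_of]
  refine of_mem_chainsIn fun t => ?_
  rw [coneSimplex_apply]
  split_ifs with h
  · exact hS hb (hσ _) (stdSimplex.zero_le t 0) (by linarith) (by ring)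
  · exact hb

theorem acyclicBelow_of_convex {S : Set E} (hS : Convex ℝ S) (hne : S.Nonempty) (d : ℕ) :
    AcyclicBelow K S d := by
  obtain ⟨b, hb⟩ := hne
  exact fun k _ z hz hc => ⟨cone K b k z, cone_mem hS hb hz, boundary_cone hc⟩

/-! ### The complement of a point in Euclidean space -/

/-- A form of the nerve theorem: a union of convex open sets any `d` of which meet is acyclic
below `d`. -/
theorem acyclicBelow_biUnion {ι : Type*} {s : Finset ι} (hs : s.Nonempty) (d : ℕ)
    (U : ι → Set E) (hU : ∀ i, IsOpen (U i)) (hc : ∀ i, Convex ℝ (U i))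
    (hne : ∀ t ⊆ s, t.card ≤ d → (⋂ i ∈ t, U i).Nonempty) :
    AcyclicBelow K (⋃ i ∈ s, U i) d := by
  classical
  induction hs using Finset.Nonempty.cons_induction generalizing d U with
  | singleton a =>
    cases d with
    | zero => exact fun k hk => absurd hk (Nat.not_lt_zero k)
    | succ d =>
      have h := hne {a} subset_rfl (by simp)
      rw [Finset.set_biInter_singleton] at h
      rw [Finset.set_biUnion_singleton]
      exact acyclicBelow_of_convex (hc a) h _
  | cons a s ha hs ih =>
    cases d with
    | zero => exact fun k hk => absurd hk (Nat.not_lt_zero k)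
    | succ d =>
      rw [Finset.cons_eq_insert] at hne ⊢
      rw [Finset.set_biUnion_insert]
      refine AcyclicBelow.union (hU a) (isOpen_biUnion fun i _ => hU i) ?_ ?_ ?_
      · have h := hne {a} (by simp) (by simp)
        rw [Finset.set_biInter_singleton] at h
        exact acyclicBelow_of_convex (hc a) h _
      · exact ih (d + 1) U hU hc fun t ht hd => hne t (ht.trans (Finset.subset_insert a s)) hd
      · rw [Set.inter_iUnion₂]
        refine ih d (fun i => U a ∩ U i) (fun i => (hU a).inter (hU i))
          (fun i => (hc a).inter (hc i)) fun t ht hd => ?_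
        obtain ⟨x, hx⟩ := hne (insert a t) (Finset.insert_subset_insert a ht)
          ((Finset.card_insert_le a t).trans (by omega))
        rw [Finset.set_biInter_insert] at hx
        exact ⟨x, Set.mem_iInter₂.2 fun i hi => ⟨hx.1, Set.mem_iInter₂.1 hx.2 i hi⟩⟩

/-- `ℝᴺ ∖ {0}` is covered by the `N + 1` half-spaces `{xᵢ > 0}` and `{∑ xᵢ < 0}`, any `N` of which
have a common point. -/
theorem acyclicBelow_compl_zero (N : ℕ) :
    AcyclicBelow K ({0}ᶜ : Set (EuclideanSpace ℝ (Fin N))) N := by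
  classical
  let L : Option (Fin N) → EuclideanSpace ℝ (Fin N) → ℝ := fun o x =>
    o.elim (-∑ i, x i) fun i => x i
  have hLc : ∀ o, Continuous (L o) := by
    rintro (_ | i) <;> simp only [L, Option.elim] <;> fun_prop
  have hLa : ∀ o x y, L o (x + y) = L o x + L o y := by
    rintro (_ | i) x y <;> simp [L, Finset.sum_add_distrib, add_comm]
  have hLs : ∀ o (c : ℝ) x, L o (c • x) = c * L o x := by
    rintro (_ | i) c x <;> simp [L, Finset.mul_sum]
  have hunion : ({0}ᶜ : Set (EuclideanSpace ℝ (Fin N))) =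
      ⋃ o ∈ (Finset.univ : Finset (Option (Fin N))), {x | 0 < L o x} := by
    ext x
    simp only [Set.mem_compl_iff, Set.mem_singleton_iff, Finset.mem_univ, Set.iUnion_true,
      Set.mem_iUnion, Set.mem_ofPred_eq]
    constructor
    · intro hx
      by_contra! h
      have h1 : ∀ i, x i ≤ 0 := fun i => h (some i)
      have h2 : -∑ i, x i ≤ 0 := h none
      have h3 : ∑ i, x i = 0 := le_antisymm (Finset.sum_nonpos fun i _ => h1 i) (by linarith)
      refine hx ?_
      ext i
      exact (Finset.sum_eq_zero_iff_of_nonpos fun i _ => h1 i).1 h3 i (Finset.mem_univ i)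
    · rintro ⟨o, ho⟩ rfl
      have := hLs o 0 0
      rw [zero_smul, zero_mul] at this
      exact ho.ne' this
  rw [hunion]
  refine acyclicBelow_biUnion Finset.univ_nonempty N _
    (fun o => isOpen_lt continuous_const (hLc o)) (fun o x hx y hy a b ha hb hab => ?_)
    fun t _ ht => ?_
  · simp only [Set.mem_ofPred_eq] at hx hy ⊢
    rw [hLa, hLs, hLs]
    rcases ha.eq_or_lt with rfl | ha
    · rw [zero_add] at hab
      simpa [hab] using hy
    · exact add_pos_of_pos_of_nonneg (mul_pos ha hx) (mul_nonneg hb hy.le)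
  · obtain ⟨o, ho⟩ : ∃ o, o ∉ t := by
      by_contra! h
      have h1 : t.card = N + 1 := by
        rw [Finset.eq_univ_of_forall h, Finset.card_univ, Fintype.card_option, Fintype.card_fin]
      omega
    suffices h : ∃ x, ∀ o' ≠ o, 0 < L o' x by
      obtain ⟨x, hx⟩ := h
      exact ⟨x, Set.mem_iInter₂.2 fun o' ho' => hx o' fun h => ho (h ▸ ho')⟩
    cases o with
    | none =>
      refine ⟨WithLp.toLp 2 fun _ => 1, ?_⟩
      rintro (_ | i) h
      · exact absurd rfl h
      · simp [L]
    | some j =>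
      refine ⟨WithLp.toLp 2 fun i => if i = j then -N else 1, ?_⟩
      rintro (_ | i) h
      · have hN : (1 : ℝ) ≤ N := by exact_mod_cast j.pos
        simp [L, Finset.sum_ite, Finset.filter_ne', Finset.filter_eq', Nat.cast_sub j.pos]
      · have : i ≠ j := fun hij => h (congrArg some hij)
        simp [L, this]

/-! ### Removing a point from a manifold -/

/-- Relative acyclicity of a space modulo the complement of a point with a neighbourhood
homeomorphic to `ℝᴺ`. -/
theorem exists_relative_boundary {N : ℕ} {e : EuclideanSpace ℝ (Fin N) → X}
    (he : Topology.IsOpenEmbedding e) (hcl : IsClosed {e 0}) {k : ℕ} (hk : k < N)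
    {z : Chain K X (k + 1)} (hz : boundary K k z ∈ chainsIn K {e 0}ᶜ k) :
    ∃ w : Chain K X (k + 2), z - boundary K (k + 1) w ∈ chainsIn K {e 0}ᶜ (k + 1) := by
  have hcov : Set.range e ∪ {e 0}ᶜ = Set.univ :=
    Set.eq_univ_of_forall fun x => by
      by_cases hx : x = e 0
      · exact Or.inl ⟨0, hx.symm⟩
      · exact Or.inr hx
  obtain ⟨u, hu, a, ha, w, -, t, ht, h⟩ := exists_decomposition (T := {e 0}ᶜ)
    he.isOpen_range hcl.isOpen_compl (z := z) (by rw [hcov, chainsIn_univ]; trivial) hz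
  have himage : e '' {0}ᶜ = Set.range e ∩ {e 0}ᶜ := by
    ext x
    constructor
    · rintro ⟨v, hv, rfl⟩
      exact ⟨⟨v, rfl⟩, fun h => hv (he.injective h)⟩
    · rintro ⟨⟨v, rfl⟩, hv⟩
      exact ⟨v, fun h => hv (congrArg e h), rfl⟩
  have hbu : boundary K k u ∈ chainsIn K (e '' {0}ᶜ) k := by
    rw [himage, chainsIn_inter]
    refine ⟨boundary_mem hu, ?_⟩
    have : boundary K k u = boundary K k z - boundary K k a - boundary K k t := by
      rw [h]
      simp only [map_add, boundary_boundary]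
      abel
    rw [this]
    exact sub_mem (sub_mem hz (boundary_mem ha)) (boundary_mem ht)
  obtain ⟨v, hv, hvu⟩ := (acyclicBelow_compl_zero N).image he.isEmbedding k hk _ hbu
    (isCycle_boundary u)
  rw [himage, chainsIn_inter] at hv
  obtain ⟨c, -, hc⟩ := (acyclicBelow_of_convex (K := K)
    (convex_univ (E := EuclideanSpace ℝ (Fin N)))
    Set.univ_nonempty (k + 2)).image he.isEmbedding (k + 1) (by omega) (u - v)
    (by rw [Set.image_univ]; exact sub_mem hu hv.1)
    (show boundary K k _ = 0 by rw [map_sub, hvu, sub_self])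
  refine ⟨c + w, ?_⟩
  have : z - boundary K (k + 1) (c + w) = v + a + t := by
    rw [map_add, hc, h]
    abel
  rw [this]
  exact add_mem (add_mem hv.2 ha) ht

end SingularChain

end

/-! ### Pulling back cochains -/

noncomputable section

namespace SingularCohomology

variable {K : Type*} [Field K] {X Y Z : Type*} [TopologicalSpace X] [TopologicalSpace Y]
  [TopologicalSpace Z] {n : ℕ}

variable (K) in
/-- The map of cochains induced by a continuous map. -/
def pullback (f : C(Y, X)) (n : ℕ) : Cochain K X n →ₗ[K] Cochain K Y n :=
  LinearMap.funLeft K K fun σ => f.comp σ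

theorem pullback_comp (f : C(Y, X)) (g : C(Z, Y)) (α : Cochain K X n) :
    pullback K (f.comp g) n α = pullback K g n (pullback K f n α) := rfl

theorem pullback_coboundary (f : C(Y, X)) (α : Cochain K X n) :
    pullback K f (n + 1) (coboundary K X n α) = coboundary K Y n (pullback K f n α) := rfl

theorem pullback_cup (f : C(Y, X)) {p q : ℕ} (h : p + q = n) (α : Cochain K X p)
    (β : Cochain K X q) :
    pullback K f n (cup K h α β) = cup K h (pullback K f p α) (pullback K f q β) := rfl

theorem pullback_mem_cocycles (f : C(Y, X)) {α : Cochain K X n} (h : α ∈ cocycles K X n) :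
    pullback K f n α ∈ cocycles K Y n := by
  rw [cocycles, LinearMap.mem_ker] at h ⊢
  rw [← pullback_coboundary, h, map_zero]

theorem pullback_mem_coboundaries (f : C(Y, X)) {α : Cochain K X n}
    (h : α ∈ coboundaries K X n) : pullback K f n α ∈ coboundaries K Y n := by
  cases n with
  | zero =>
    have : α = 0 := h
    rw [this, map_zero]
    exact zero_mem _
  | succ n =>
    obtain ⟨β, rfl⟩ := h
    exact ⟨pullback K f n β, (pullback_coboundary f β).symm⟩

theorem cls_eq_iff (a b : cocycles K X n) : cls a = cls b ↔ a.1 - b.1 ∈ coboundaries K X n := by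
  rw [Submodule.Quotient.eq]
  rfl

theorem cls_eq_zero_iff (a : cocycles K X n) : cls a = 0 ↔ a.1 ∈ coboundaries K X n := by
  rw [Submodule.Quotient.mk_eq_zero]
  rfl

/-- A class lies in the indeterminacy `[a] H^t + H^s [c]` of a Massey product if and only if it is
represented by a cocycle of the form `a ∪ y + z ∪ c`. -/
theorem cls_mem_indeterminacy_iff {p r s t : ℕ} (hl : p + t = n) (hr : s + r = n)
    (a : cocycles K X p) (c : cocycles K X r) (m : cocycles K X n) :
    cls m ∈ LinearMap.range (cupLeft hl a) ⊔ LinearMap.range (cupRight hr c) ↔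
      ∃ y ∈ cocycles K X t, ∃ z ∈ cocycles K X s,
        cup K hl a.1 y + cup K hr z c.1 - m.1 ∈ coboundaries K X n := by
  rw [Submodule.mem_sup]
  constructor
  · rintro ⟨_, ⟨y, rfl⟩, _, ⟨z, rfl⟩, h⟩
    obtain ⟨y, rfl⟩ := Submodule.Quotient.mk_surjective _ y
    obtain ⟨z, rfl⟩ := Submodule.Quotient.mk_surjective _ z
    have h' : cls (⟨_, cup_mem_cocycles hl a.2 y.2⟩ + ⟨_, cup_mem_cocycles hr z.2 c.2⟩) = cls m := h
    exact ⟨y, y.2, z, z.2, (cls_eq_iff _ _).1 h'⟩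
  · rintro ⟨y, hy, z, hz, h⟩
    have h' : cls (⟨_, cup_mem_cocycles hl a.2 hy⟩ + ⟨_, cup_mem_cocycles hr hz c.2⟩) = cls m :=
      (cls_eq_iff _ _).2 h
    exact ⟨_, ⟨cls ⟨y, hy⟩, rfl⟩, _, ⟨cls ⟨z, hz⟩, rfl⟩, h'⟩

/-- If `A → Y → X` induces a surjection on cohomology up to degree `n` and an injection up to
degree `n + 1`, then nontrivial Massey products in `Hⁿ(X)` pull back to nontrivial ones in
`Hⁿ(Y)`: on restriction to `A` the whole indeterminacy in `Y` comes from that in `X`. -/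
theorem HasNontrivialTripleMasseyProduct.of_factorization {A : Type*} [TopologicalSpace A]
    (f : C(Y, X)) (i : C(A, Y))
    (hinj : ∀ m ≤ n + 1, ∀ α ∈ cocycles K X m,
      pullback K (f.comp i) m α ∈ coboundaries K A m → α ∈ coboundaries K X m)
    (hsurj : ∀ m ≤ n, ∀ β ∈ cocycles K A m, ∃ α ∈ cocycles K X m,
      pullback K (f.comp i) m α - β ∈ coboundaries K A m)
    (h : HasNontrivialTripleMasseyProduct K X n) : HasNontrivialTripleMasseyProduct K Y n := by
  obtain ⟨p, q, r, s, t, hs, ht, hn, hn', a, b, c, g, h, hg, hh, ha, hb, hc, hm⟩ := h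
  have hne : ∀ {m : ℕ} (α : cocycles K X m), m ≤ n + 1 → cls α ≠ 0 →
      cls (⟨_, pullback_mem_cocycles f α.2⟩ : cocycles K Y m) ≠ 0 := by
    intro m α hmn hα h0
    rw [cls_eq_zero_iff] at h0
    refine hα ((cls_eq_zero_iff α).2 (hinj m hmn α α.2 ?_))
    rw [pullback_comp]
    exact pullback_mem_coboundaries i h0
  refine ⟨p, q, r, s, t, hs, ht, hn, hn', ⟨_, pullback_mem_cocycles f a.2⟩,
    ⟨_, pullback_mem_cocycles f b.2⟩, ⟨_, pullback_mem_cocycles f c.2⟩, pullback K f s g,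
    pullback K f t h, ?_, ?_, hne a (by omega) ha, hne b (by omega) hb, hne c (by omega) hc, ?_⟩
  · rw [← pullback_cup, hg, pullback_coboundary]
  · rw [← pullback_cup, hh, pullback_coboundary]
  rw [cls_mem_indeterminacy_iff] at hm ⊢
  rintro ⟨y, hy, z, hz, hyz⟩
  obtain ⟨y', hy', hyy⟩ := hsurj t (by omega) _ (pullback_mem_cocycles i hy)
  obtain ⟨z', hz', hzz⟩ := hsurj s (by omega) _ (pullback_mem_cocycles i hz)
  refine hm ⟨y', hy', z', hz', hinj n (by omega) _ (sub_mem (add_mem (cup_mem_cocycles hn' a.2 hy')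
    (cup_mem_cocycles hn hz' c.2)) (massey_mem_cocycles hs ht hn hn' a b c g h hg hh)) ?_⟩
  have h1 := pullback_mem_coboundaries i hyz
  have h2 := cup_mem_coboundaries_right hn' (pullback_mem_cocycles (f.comp i) a.2) hyy
  have h3 := cup_mem_coboundaries_left hn hzz (pullback_mem_cocycles (f.comp i) c.2)
  convert add_mem (add_mem h1 h2) h3 using 1
  simp only [map_add, map_sub, map_smul, pullback_cup, pullback_comp, LinearMap.sub_apply]
  abel

/-! ### Cohomology of the complement of a point -/

/-- The evaluation of a cochain on chains. -/
def eval (α : Cochain K X n) : SingularChain.Chain K X (n + 1) →ₗ[K] K :=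
  Finsupp.linearCombination K α

theorem eval_of (α : Cochain K X n) (σ : C(stdSimplex ℝ (Fin (n + 1)), X)) :
    eval α (SingularChain.of K σ) = α σ := by
  simp [eval, SingularChain.of]

theorem eval_coboundary (α : Cochain K X n) (z : SingularChain.Chain K X (n + 2)) :
    eval (coboundary K X n α) z = eval α (SingularChain.boundary K (n + 1) z) := by
  suffices h : eval (coboundary K X n α) = eval α ∘ₗ SingularChain.boundary K (n + 1) from
    LinearMap.congr_fun h z
  refine SingularChain.ext_of fun σ => ?_
  rw [eval_of, LinearMap.comp_apply, SingularChain.boundary_of, map_sum]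
  change ∑ i : Fin (n + 2), (-1 : K) ^ (i : ℕ) * α (σ.comp (simplexMap i.succAbove)) = _
  refine Finset.sum_congr rfl fun i _ => ?_
  rw [map_smul, eval_of, SimplexAffine.simplexMap_eq_affine]
  rfl

theorem coboundary_mem_cocycles (α : Cochain K X n) :
    coboundary K X n α ∈ cocycles K X (n + 1) := by
  rw [cocycles, LinearMap.mem_ker]
  funext σ
  rw [← eval_of (coboundary K X (n + 1) _) σ, eval_coboundary, eval_coboundary,
    SingularChain.boundary_boundary, map_zero]
  rfl

theorem eq_coboundary_of_comp_boundary {α : Cochain K X (n + 1)}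
    {ζ : SingularChain.Chain K X (n + 1) →ₗ[K] K}
    (h : ∀ z, eval α z = ζ (SingularChain.boundary K (n + 1) z)) :
    α = coboundary K X n fun σ => ζ (SingularChain.of K σ) := by
  have hζ : eval (fun σ => ζ (SingularChain.of K σ)) = ζ :=
    SingularChain.ext_of fun σ => eval_of _ σ
  funext σ
  rw [← eval_of α, ← eval_of (coboundary K X n _), eval_coboundary, hζ, h]

/-- The inclusion of a subspace. -/
def incl (A : Set X) : C(A, X) := ⟨Subtype.val, continuous_subtype_val⟩

open Classical in
/-- The extension by zero of a cochain on a subspace. -/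
def extendZero {A : Set X} (β : Cochain K A n) : Cochain K X n := fun σ =>
  if h : ∀ t, σ t ∈ A then β ⟨fun t => ⟨σ t, h t⟩, σ.continuous.subtype_mk h⟩ else 0

theorem pullback_extendZero {A : Set X} (β : Cochain K A n) :
    pullback K (incl A) n (extendZero β) = β := by
  funext σ
  exact dif_pos fun t => (σ t).2

theorem eq_zero_of_pullback_eq_zero {A : Set X} {α : Cochain K X n}
    (h : pullback K (incl A) n α = 0) (σ : C(stdSimplex ℝ (Fin (n + 1)), X))
    (hσ : ∀ t, σ t ∈ A) : α σ = 0 :=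
  congrFun h ⟨fun t => ⟨σ t, hσ t⟩, σ.continuous.subtype_mk hσ⟩

variable {N : ℕ} {e : EuclideanSpace ℝ (Fin N) → X}

/-- The dual of relative acyclicity: over a field, a relative cocycle of `X` modulo the complement
of a point is the coboundary of a relative cochain. In degree `0` the linear form `ζ` lives on the
augmentation and vanishes. -/
theorem exists_relative_primitive (he : Topology.IsOpenEmbedding e) (hcl : IsClosed {e 0})
    (hn : n < N) {α : Cochain K X n} (hα : α ∈ cocycles K X n)
    (hA : pullback K (incl {e 0}ᶜ) n α = 0) :
    ∃ ζ : SingularChain.Chain K X n →ₗ[K] K, (∀ z ∈ SingularChain.chainsIn K {e 0}ᶜ n, ζ z = 0) ∧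
      ∀ z, eval α z = ζ (SingularChain.boundary K n z) := by
  let S : Submodule K (SingularChain.Chain K X n) := SingularChain.chainsIn K {e 0}ᶜ n
  let φ : SingularChain.Chain K X (n + 1) →ₗ[K] _ ⧸ S := S.mkQ ∘ₗ SingularChain.boundary K n
  have hvanish : SingularChain.chainsIn K {e 0}ᶜ (n + 1) ≤ LinearMap.ker (eval α) :=
    SingularChain.chainsIn_le.2 fun σ hσ => by
      rw [LinearMap.mem_ker, eval_of]
      exact eq_zero_of_pullback_eq_zero hA σ hσ
  have hker : LinearMap.ker φ ≤ LinearMap.ker (eval α) := by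
    intro z hz
    have hz : SingularChain.boundary K n z ∈ S := by
      rwa [LinearMap.mem_ker, LinearMap.comp_apply, Submodule.mkQ_apply,
        Submodule.Quotient.mk_eq_zero] at hz
    obtain ⟨w, hw⟩ := SingularChain.exists_relative_boundary he hcl hn hz
    have h1 : eval α (SingularChain.boundary K (n + 1) w) = 0 := by
      rw [← eval_coboundary, LinearMap.mem_ker.1 hα]
      simp [eval]
    have h2 := LinearMap.mem_ker.1 (hvanish hw)
    rwa [map_sub, h1, sub_zero] at h2
  have hmem : eval α ∈ LinearMap.range φ.dualMap := by
    rw [LinearMap.range_dualMap_eq_dualAnnihilator_ker, Submodule.mem_dualAnnihilator]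
    exact fun z hz => hker hz
  obtain ⟨ψ, hψ⟩ := hmem
  refine ⟨ψ ∘ₗ S.mkQ, fun z hz => ?_, fun z => ?_⟩
  · rw [LinearMap.comp_apply, Submodule.mkQ_apply, (Submodule.Quotient.mk_eq_zero S).2 hz, map_zero]
  · exact (LinearMap.congr_fun hψ z).symm

theorem mem_coboundaries_of_pullback_compl (he : Topology.IsOpenEmbedding e)
    (hcl : IsClosed {e 0}) (hn : n < N) {α : Cochain K X n} (hα : α ∈ cocycles K X n)
    (h : pullback K (incl {e 0}ᶜ) n α ∈ coboundaries K _ n) : α ∈ coboundaries K X n := by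
  cases n with
  | zero =>
    obtain ⟨ζ, hζ, hαζ⟩ := exists_relative_primitive he hcl hn hα h
    change α = 0
    funext σ
    rw [← eval_of α, hαζ]
    exact hζ _ (by rw [SingularChain.chainsIn_zero]; trivial)
  | succ n =>
    obtain ⟨β, hβ⟩ := h
    obtain ⟨ζ, -, hαζ⟩ := exists_relative_primitive he hcl hn
      (sub_mem hα (coboundary_mem_cocycles (extendZero β)))
      (by rw [map_sub, pullback_coboundary, pullback_extendZero, hβ, sub_self])
    rw [← sub_add_cancel α (coboundary K X n (extendZero β)), eq_coboundary_of_comp_boundary hαζ]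
    exact add_mem ⟨_, rfl⟩ ⟨_, rfl⟩

theorem exists_pullback_compl_eq (he : Topology.IsOpenEmbedding e) (hcl : IsClosed {e 0})
    (hn : n + 1 < N) {β : Cochain K ({e 0}ᶜ : Set X) n} (hβ : β ∈ cocycles K _ n) :
    ∃ α ∈ cocycles K X n, pullback K (incl {e 0}ᶜ) n α = β := by
  obtain ⟨ζ, hζ, hβζ⟩ := exists_relative_primitive he hcl hn
    (coboundary_mem_cocycles (extendZero β))
    (by rw [pullback_coboundary, pullback_extendZero, LinearMap.mem_ker.1 hβ])
  refine ⟨extendZero β - fun σ => ζ (SingularChain.of K σ), ?_, ?_⟩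
  · rw [cocycles, LinearMap.mem_ker, map_sub, ← eq_coboundary_of_comp_boundary hβζ, sub_self]
  · rw [map_sub, pullback_extendZero, sub_eq_self]
    funext σ
    exact hζ _ (SingularChain.of_mem_chainsIn fun t => (σ t).2)

end SingularCohomology

end

/-! ### Collapsing a summand of a connected sum -/

noncomputable section

namespace ConnectedSum

open Topology

variable {N : ℕ} {X : Type*}

open Classical in
/-- The map of `X` which is `φ` in the coordinates `e` and the identity elsewhere. -/
def transport (e : EuclideanSpace ℝ (Fin N) → X)
    (φ : EuclideanSpace ℝ (Fin N) → EuclideanSpace ℝ (Fin N)) (x : X) : X :=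
  if h : ∃ v, e v = x then e (φ h.choose) else x

theorem transport_apply [TopologicalSpace X] {e : EuclideanSpace ℝ (Fin N) → X}
    (he : IsOpenEmbedding e)
    (φ : EuclideanSpace ℝ (Fin N) → EuclideanSpace ℝ (Fin N)) (v : EuclideanSpace ℝ (Fin N)) :
    transport e φ (e v) = e (φ v) := by
  have h : ∃ w, e w = e v := ⟨v, rfl⟩
  rw [transport, dif_pos h, he.injective h.choose_spec]

theorem transport_of_notMem {e : EuclideanSpace ℝ (Fin N) → X}
    (φ : EuclideanSpace ℝ (Fin N) → EuclideanSpace ℝ (Fin N)) {x : X} (hx : x ∉ Set.range e) :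
    transport e φ x = x :=
  dif_neg hx

/-- The two pieces of `transport e φ` fit together continuously, because in a Hausdorff space the
compact set `e '' closedBall 0 2` is closed and `φ` is the identity outside that ball. -/
theorem continuousAt_transport [TopologicalSpace X] [T2Space X] {e : EuclideanSpace ℝ (Fin N) → X}
    (he : IsOpenEmbedding e) {φ : EuclideanSpace ℝ (Fin N) → EuclideanSpace ℝ (Fin N)}
    (hφ : ∀ v, 2 ≤ ‖v‖ → φ v = v) {x : X} (hx : ∀ v, e v = x → ContinuousAt φ v) :
    ContinuousAt (transport e φ) x := by
  by_cases h : x ∈ Set.range e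
  · obtain ⟨v, rfl⟩ := h
    rw [← he.continuousAt_iff]
    have : transport e φ ∘ e = e ∘ φ := funext fun w => transport_apply he φ w
    rw [this]
    exact he.continuous.continuousAt.comp (hx v rfl)
  · have hcl : IsClosed (e '' Metric.closedBall 0 2) :=
      ((isCompact_closedBall _ _).image he.continuous).isClosed
    have hev : transport e φ =ᶠ[𝓝 x] id := by
      filter_upwards [hcl.isOpen_compl.mem_nhds
        (fun ⟨v, _, hv⟩ => h ⟨v, hv⟩ : x ∈ (e '' Metric.closedBall 0 2)ᶜ)] with y hy
      by_cases hy' : y ∈ Set.range e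
      · obtain ⟨v, rfl⟩ := hy'
        have hv : 2 ≤ ‖v‖ := by
          by_contra! hv
          exact hy ⟨v, by simpa using hv.le, rfl⟩
        rw [transport_apply he, hφ v hv, id]
      · exact transport_of_notMem φ hy'
    exact continuousAt_id.congr hev.symm

/-- The radial map of `ℝᴺ` which collapses the closed unit ball to the origin, stretches the shell
`1 ≤ ‖v‖ ≤ 2` to the ball of radius `2` by `‖v‖ ↦ 2 (‖v‖ - 1)`, and is the identity outside. -/
def collapseBall (v : EuclideanSpace ℝ (Fin N)) : EuclideanSpace ℝ (Fin N) :=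
  min 1 (2 - 2 / max ‖v‖ 1) • v

theorem continuous_collapseBall : Continuous (collapseBall (N := N)) := by
  have h : ∀ v : EuclideanSpace ℝ (Fin N), max ‖v‖ 1 ≠ 0 := fun v =>
    (lt_max_of_lt_right one_pos).ne'
  unfold collapseBall
  fun_prop (disch := assumption)

theorem collapseBall_of_le {v : EuclideanSpace ℝ (Fin N)} (hv : ‖v‖ ≤ 1) : collapseBall v = 0 := by
  rw [collapseBall, max_eq_right hv]
  norm_num

theorem collapseBall_of_ge {v : EuclideanSpace ℝ (Fin N)} (hv : 2 ≤ ‖v‖) : collapseBall v = v := by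
  have h : 2 / ‖v‖ ≤ 1 := (div_le_one (by linarith)).2 hv
  rw [collapseBall, max_eq_left (by linarith), min_eq_left (by linarith), one_smul]

/-- The right inverse of `collapseBall` on nonzero vectors, `‖v‖ ↦ 1 + ‖v‖ / 2` for `‖v‖ ≤ 2`. -/
def expandPoint (v : EuclideanSpace ℝ (Fin N)) : EuclideanSpace ℝ (Fin N) :=
  (max (1 + ‖v‖ / 2) ‖v‖ / ‖v‖) • v

theorem continuousAt_expandPoint {v : EuclideanSpace ℝ (Fin N)} (hv : v ≠ 0) :
    ContinuousAt expandPoint v := by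
  have h : ‖v‖ ≠ 0 := norm_ne_zero_iff.2 hv
  unfold expandPoint
  fun_prop (disch := assumption)

theorem norm_expandPoint {v : EuclideanSpace ℝ (Fin N)} (hv : v ≠ 0) :
    ‖expandPoint v‖ = max (1 + ‖v‖ / 2) ‖v‖ := by
  have h : 0 < ‖v‖ := norm_pos_iff.2 hv
  have h1 : 0 ≤ max (1 + ‖v‖ / 2) ‖v‖ := h.le.trans (le_max_right _ _)
  rw [expandPoint, norm_smul, Real.norm_of_nonneg (by positivity), div_mul_cancel₀ _ h.ne']

theorem expandPoint_of_ge {v : EuclideanSpace ℝ (Fin N)} (hv : 2 ≤ ‖v‖) : expandPoint v = v := by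
  rw [expandPoint, max_eq_right (by linarith), div_self (by linarith), one_smul]

theorem collapseBall_expandPoint {v : EuclideanSpace ℝ (Fin N)} (hv : v ≠ 0) :
    collapseBall (expandPoint v) = v := by
  rcases le_total 2 ‖v‖ with h2 | h2
  · rw [expandPoint_of_ge h2, collapseBall_of_ge h2]
  · have h : 0 < ‖v‖ := norm_pos_iff.2 hv
    have hm : max (1 + ‖v‖ / 2) ‖v‖ = 1 + ‖v‖ / 2 := max_eq_left (by linarith)
    have h1 : 1 ≤ 2 / (1 + ‖v‖ / 2) := by
      rw [le_div_iff₀ (by linarith)]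
      linarith
    rw [collapseBall, norm_expandPoint hv, hm, max_eq_left (by linarith),
      min_eq_right (by linarith), expandPoint, hm, smul_smul]
    convert one_smul ℝ v using 2
    field_simp
    ring

theorem transport_expandPoint_notMem [TopologicalSpace X] {e : EuclideanSpace ℝ (Fin N) → X}
    (he : IsOpenEmbedding e) {x : X} (hx : x ≠ e 0) :
    transport e expandPoint x ∉ e '' Metric.ball 0 1 := by
  rintro ⟨w, hw, h⟩
  by_cases hr : x ∈ Set.range e
  · obtain ⟨v, rfl⟩ := hr
    have hv : v ≠ 0 := fun h => hx (congrArg e h)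
    rw [transport_apply he] at h
    rw [he.injective h, mem_ball_zero_iff, norm_expandPoint hv] at hw
    have := norm_nonneg v
    linarith [le_max_left (1 + ‖v‖ / 2) ‖v‖]
  · rw [transport_of_notMem _ hr] at h
    exact hr ⟨w, h⟩

variable {X₁ X₂ : Type*} [TopologicalSpace X₁] [TopologicalSpace X₂] [T2Space X₁]
  {e₁ : EuclideanSpace ℝ (Fin N) → X₁} (he₁ : IsOpenEmbedding e₁)
  (e₂ : EuclideanSpace ℝ (Fin N) → X₂)

/-- The map `X₁ # X₂ → X₁` which collapses the second summand to the centre of the disc. -/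
def collapse : C(ConnectedSum e₁ e₂, X₁) where
  toFun := Quot.lift (Sum.elim (fun x => transport e₁ collapseBall x.1) fun _ => e₁ 0) <| by
    rintro _ _ ⟨v, hv, x₁, x₂, rfl, rfl, h₁, -⟩
    rw [Sum.elim_inl, Sum.elim_inr, h₁, transport_apply he₁, collapseBall_of_le hv.le]
  continuous_toFun := by
    refine continuous_quot_lift _ (continuous_sumElim.2 ⟨?_, continuous_const⟩)
    refine (continuous_iff_continuousAt.2 fun x => ?_ :
      Continuous (transport e₁ collapseBall)).comp continuous_subtype_val
    exact continuousAt_transport he₁ (fun v => collapseBall_of_ge) fun v _ =>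
      continuous_collapseBall.continuousAt

/-- The section of `collapse` over the complement of the centre of the disc. -/
def expand : C(({e₁ 0}ᶜ : Set X₁), ConnectedSum e₁ e₂) where
  toFun x := Quot.mk _ (Sum.inl ⟨_, transport_expandPoint_notMem he₁ x.2⟩)
  continuous_toFun := by
    refine continuous_quot_mk.comp (continuous_inl.comp (Continuous.subtype_mk ?_ _))
    refine continuous_iff_continuousAt.2 fun x => ContinuousAt.comp (f := Subtype.val)
      (continuousAt_transport he₁ (fun v => expandPoint_of_ge) fun v hv => ?_)
      continuous_subtype_val.continuousAt
    exact continuousAt_expandPoint fun h => x.2 (by rw [← hv, h]; rfl)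

theorem collapse_comp_expand :
    (collapse he₁ e₂).comp (expand he₁ e₂) = SingularCohomology.incl {e₁ 0}ᶜ := by
  ext x
  change transport e₁ collapseBall (transport e₁ expandPoint x.1) = x.1
  by_cases hr : x.1 ∈ Set.range e₁
  · obtain ⟨v, hv⟩ := hr
    have hv0 : v ≠ 0 := fun h => x.2 (by rw [← hv, h]; rfl)
    rw [← hv, transport_apply he₁, transport_apply he₁, collapseBall_expandPoint hv0]
  · rw [transport_of_notMem _ hr, transport_of_notMem _ hr]

end ConnectedSum

end

theorem proposition22 {K : Type*} [Field K] [CharZero K] (N q : ℕ) (hq : q + 3 ≤ N)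
    {X₁ X₂ : Type*}
    [TopologicalSpace X₁] [T2Space X₁] [SecondCountableTopology X₁]
    [ChartedSpace (EuclideanSpace ℝ (Fin N)) X₁] [SimplyConnectedSpace X₁]
    [TopologicalSpace X₂] [T2Space X₂] [SecondCountableTopology X₂]
    [ChartedSpace (EuclideanSpace ℝ (Fin N)) X₂] [SimplyConnectedSpace X₂]
    (e₁ : EuclideanSpace ℝ (Fin N) → X₁) (he₁ : Topology.IsOpenEmbedding e₁)
    (e₂ : EuclideanSpace ℝ (Fin N) → X₂) (he₂ : Topology.IsOpenEmbedding e₂)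
    (h : SingularCohomology.HasNontrivialTripleMasseyProduct K X₁ q) :
    SingularCohomology.HasNontrivialTripleMasseyProduct K (ConnectedSum e₁ e₂) q := by
  refine .of_factorization (ConnectedSum.collapse he₁ e₂) (ConnectedSum.expand he₁ e₂) ?_ ?_ h
  · intro m hm α hα hc
    rw [ConnectedSum.collapse_comp_expand] at hc
    exact SingularCohomology.mem_coboundaries_of_pullback_compl he₁ isClosed_singleton
      (by omega) hα hc
  · intro m hm β hβ
    obtain ⟨α, hα, hαβ⟩ := SingularCohomology.exists_pullback_compl_eq he₁ isClosed_singleton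
      (by omega) hβ
    refine ⟨α, hα, ?_⟩
    rw [ConnectedSum.collapse_comp_expand, hαβ, sub_self]
    exact zero_mem _
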